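/- Let $p,q$ be coprime integers with $|p|,|q|\ge 2$, and let $D(p,q)$ be the standard closed-braid diagram of the $(p,q)$-torus knot with $|p|$ strands, consisting of $|q|$ equal blocks in each of which one outermost strand passes over all the others; its arcs are $a_{ij}$ ($0\le i<|q|$, $0\le j<|p|$), where the over strand $a_{i0}$ of the $i$-th block is the same arc as $a_{i+1,|p|-1}$ and $a_{ij}$ ($j\ge 1$) continues as $a_{i+1,j-1}$ after passing under $a_{i0}$ (first index modulo $|q|$). Let $\mathrm{Rot}\,\mathbb E^2=\mathbb C\times \mathrm U(1)$ be the quandle with $(z,a)*(w,b)=((z-w)b+w,\,a)$. A regular polygon of type $(m,k)$ is a sequence of vertices $c+re^{2\pi\sqrt{-1}\,ik/m}$ ($i\in\mathbb Z/m$; $c,r\in\mathbb C$, $r\ne 0$). Let $1\le k\le |p|-1$, $1\le l\le |q|-1$. Let $Q$ be a regular polygon of type $(|q|,l)$ with vertices $v_0,v_1,\dots$ and side length $1$, and let $P_0$ be a regular polygon of type $(|p|,k)$ with vertices $w_{00},w_{01},\dots$ such that $w_{00}=v_0$ and $w_{01}=v_1$. Put $\theta=\left(\frac{|p|-2k}{|p|}-\frac{|q|-2l}{|q|}\right)\pi$.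 For $i\ge 1$ let $P_i$, with vertices $w_{ij}$, be the image of $P_{i-1}$ under the rotation about $v_i$ by the angle $\theta$, where $w_{ij}$ is the image of $w_{i-1,j}$. Let $\mathscr C_0=\mathscr C(Q,P_0)$ be the coloring of $D(p,q)$ with $\mathscr C_0(a_{ij})=(w_{i,i+j+1},e^{\theta\sqrt{-1}})$, second indices being taken modulo $|p|$. A shift replaces $\mathscr C(Q,P_0)$ by $\mathscr C(Q,P_1)$, where the vertices are renamed such that the common first edge of the two polygons is $v_1v_2=w_{11}w_{12}$. A switch replaces the coloring $\mathscr C(Q,P_0)$ of $D(p,q)$ by the coloring $\mathscr C(\langle P_0\rangle,\langle Q\rangle_0)$ of $D(q,p)$, where $\langle P_0\rangle$ has the vertices $w_{01},w_{00},w_{0,|p|-1},\dots,w_{02}$ and is of type $(|p|,|p|-k)$, and $\langle Q\rangle_0$ has the vertices $v_1,v_0,v_{|q|-1},\dots,v_2$ and is of type $(|q|,|q|-l)$. Put $p'=|p|/\gcd(|p|,k)$ and $q'=|q|/\gcd(|q|,l)$, let $\alpha=p'q'/2$ if $p'q'$ is even and $\alpha=p'q'$ otherwise, and for $0\le\sigma\le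 2\alpha-1$ let $v_\sigma=\cos t_\sigma+\sqrt{-1}\sin t_\sigma$ with $t_\sigma=\arg(w_{01}-w_{00})+\sigma\pi/\alpha$. (These unit complex numbers are not to be confused with the vertices of $Q$.) Let $\mathscr W_2$ be the set of the points of $\mathbb C$ each of which some coloring of $D(p,q)$ obtained from $\mathscr C_0$ by shifts and an even number of switches uses as the first component of the color of an arc. Let $\mathscr W_3$ be the set of the points of $\mathbb C$ each of which some coloring obtained from $\mathscr C_0$ by a finite sequence of Reidemeister moves and planar isotopies uses as the first component of the color of an arc of a diagram of the $(p,q)$-torus knot. Then $$\mathscr W_3=\mathscr W_2\qquad\text{and}\qquad \mathscr W_3=\Bigl\{\,w_{00}+\sum_{0\le\sigma\le 2\alpha-1}a_\sigma v_\sigma \Bigm| a_\sigma\in\mathbb Z\Bigr\}.$$ -/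

import Mathlib

/-! ### The quandle of rotations of the Euclidean plane -/

/-- The rotations of the Euclidean plane `ℂ`: `⟨z, u⟩` is the rotation about `z` by the angle of
the unit complex number `u`. -/
@[ext] structure RotE2 where
  center : ℂ
  angle : Circle

/-- The quandle operation. In the notation of Mathlib, `y ◃ x` is what is usually written `x * y`
in knot theory: here `(z, a) * (w, b) = ((z - w) b + w, a)`. -/
noncomputable instance : Quandle RotE2 where
  act y x := ⟨(x.center - y.center) * (y.angle : ℂ) + y.center, x.angle⟩
  invAct y x := ⟨(x.center - y.center) * ((y.angle⁻¹ : Circle) : ℂ) + y.center, x.angle⟩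
  self_distrib := by
    intro x y z
    ext
    · simp only []; ring
    · rfl
  left_inv := by
    intro y x
    ext
    · have h := Circle.coe_ne_zero y.angle
      simp only [Circle.coe_inv]
      field_simp
      ring
    · rfl
  right_inv := by
    intro y x
    ext
    · have h := Circle.coe_ne_zero y.angle
      simp only [Circle.coe_inv]
      field_simp
      ring
    · rfl
  fix := by
    intro x
    ext
    · simp
    · rfl

/-! ### Oriented diagrams in the plane and their colorings

A diagram is in general position with respect to the height function of the plane and is cut by
horizontal lines into slices, each of which contains exactly one minimum, maximum or crossing. -/

/-- The possible contents of a slice. `cup o` is a minimum, whose left leg is directed upwards iff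
`o = true`; `cap` is a maximum; `cross b` is a crossing of two adjacent strands, at which the strand
from bottom left to top right passes over iff `b = true` (and under iff `b = false`). -/
inductive Shape where
  | cup (o : Bool)
  | cap
  | cross (b : Bool)

/-- The number of strands entering from below. -/
def Shape.ins : Shape → ℕ
  | .cup _ => 0
  | .cap => 2
  | .cross _ => 2

/-- The number of strands leaving above. -/
def Shape.outs : Shape → ℕ
  | .cup _ => 2
  | .cap => 0
  | .cross _ => 2

/-- A slice: the given shape, with `pos` vertical strands to the left of it (and any number of
vertical strands to the right of it). -/
structure Piece where
  pos : ℕ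
  shape : Shape

/-- Diagrams and pieces of diagrams: the list of the slices from bottom to top. -/
abbrev Diagram := List Piece

/-- A strand where it meets a horizontal line between two slices: its direction (`up = true` iff it
is directed upwards) and the color of the arc to which it belongs. -/
structure Strand (X : Type*) where
  up : Bool
  color : X

/-- A horizontal line between two slices: the strands that it meets, from left to right. -/
abbrev Level (X : Type*) := List (Strand X)

open scoped Quandles in
/-- The condition for a coloring at a minimum, a maximum or a crossing. The lists are the strands
below and above. Colors do not change at a minimum, a maximum or along the over strand. If the over
arc has color `y`, and the under arc to its right (with respect to the direction of the over arc)
has color `x`, then the under arc to its left has color `x * y`, that is `y ◃ x`. -/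
inductive Shape.Colored {X : Type*} [Quandle X] : Shape → Level X → Level X → Prop
  | cup (o : Bool) (x : X) : Shape.Colored (.cup o) [] [⟨o, x⟩, ⟨!o, x⟩]
  | cap (o : Bool) (x : X) : Shape.Colored .cap [⟨o, x⟩, ⟨!o, x⟩] []
  | overRightUp (o : Bool) (x y : X) :
      Shape.Colored (.cross true) [⟨true, y⟩, ⟨o, x⟩] [⟨o, y ◃ x⟩, ⟨true, y⟩]
  | overRightDown (o : Bool) (x y : X) :
      Shape.Colored (.cross true) [⟨false, y⟩, ⟨o, y ◃ x⟩] [⟨o, x⟩, ⟨false, y⟩]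
  | overLeftUp (o : Bool) (x y : X) :
      Shape.Colored (.cross false) [⟨o, y ◃ x⟩, ⟨true, y⟩] [⟨true, y⟩, ⟨o, x⟩]
  | overLeftDown (o : Bool) (x y : X) :
      Shape.Colored (.cross false) [⟨o, x⟩, ⟨false, y⟩] [⟨false, y⟩, ⟨o, y ◃ x⟩]

/-- The colored levels `s` and `t` fit below and above the slice `P`. -/
def Piece.Colored {X : Type*} [Quandle X] (P : Piece) (s t : Level X) : Prop :=
  ∃ L A B R : Level X, L.length = P.pos ∧ P.shape.Colored A B ∧ s = L ++ A ++ R ∧ t = L ++ B ++ R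

/-- `IsColoring s D C t`: starting from the level `s`, the members of `C` are the colored levels
directly above the slices of `D`, the last one (`s` itself if `D` is empty) is `t`, and the condition
for a coloring holds in each slice. -/
def IsColoring {X : Type*} [Quandle X] : Level X → Diagram → List (Level X) → Level X → Prop
  | s, [], [], t => s = t
  | s, P :: D, u :: C, t => P.Colored s u ∧ IsColoring u D C t
  | _, [], _ :: _, _ => False
  | _, _ :: _, [], _ => False

/-- A coloring of an oriented closed diagram: no strands at the bottom and at the top. Since the
colors agree along each arc, this is a map from the set of arcs to `X`. -/
structure Coloring (X : Type*) [Quandle X] (D : Diagram) where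
  levels : List (Level X)
  valid : IsColoring [] D levels []

/-- `C.Uses x`: the color `x` is the color of some arc. -/
def Coloring.Uses {X : Type*} [Quandle X] {D : Diagram} (C : Coloring X D) (x : X) : Prop :=
  ∃ s ∈ C.levels, ∃ a ∈ s, a.color = x

/-! ### Planar isotopies and Reidemeister moves -/

/-- The local changes of the slicing that generate planar isotopies: exchange of the heights of two
distant slices, straightening of a zigzag, and pushing a minimum or a maximum across a transversal
strand from one side of a crossing to the other. -/
inductive PlanarIsotopy : Diagram → Diagram → Prop
  | exchange (i d : ℕ) (P Q : Shape) :
      PlanarIsotopy [⟨i, P⟩, ⟨i + P.outs + d, Q⟩] [⟨i + P.ins + d, Q⟩, ⟨i, P⟩]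
  | zigzagLeft (i : ℕ) (o : Bool) : PlanarIsotopy [⟨i + 1, .cup o⟩, ⟨i, .cap⟩] []
  | zigzagRight (i : ℕ) (o : Bool) : PlanarIsotopy [⟨i, .cup o⟩, ⟨i + 1, .cap⟩] []
  | slideCap (i : ℕ) (b : Bool) :
      PlanarIsotopy [⟨i, .cross b⟩, ⟨i + 1, .cap⟩] [⟨i + 1, .cross (!b)⟩, ⟨i, .cap⟩]
  | slideCup (i : ℕ) (o b : Bool) :
      PlanarIsotopy [⟨i + 1, .cup o⟩, ⟨i, .cross b⟩] [⟨i, .cup o⟩, ⟨i + 1, .cross (!b)⟩]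

/-- The Reidemeister moves RI, RII and RIII, for all directions of the strands. In RIII, the three
strands are, from bottom left to bottom right, `0`, `1`, `2`, and `a`, `b`, `c` say whether `0` is
over `1`, `0` is over `2`, `1` is over `2`; the two cyclic choices are excluded. -/
inductive Reidemeister : Diagram → Diagram → Prop
  | oneCap (i : ℕ) (b : Bool) : Reidemeister [⟨i, .cross b⟩, ⟨i, .cap⟩] [⟨i, .cap⟩]
  | oneCup (i : ℕ) (o b : Bool) : Reidemeister [⟨i, .cup o⟩, ⟨i, .cross b⟩] [⟨i, .cup (!o)⟩]
  | two (i : ℕ) (b : Bool) : Reidemeister [⟨i, .cross b⟩, ⟨i, .cross (!b)⟩] []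
  | three (i : ℕ) (a b c : Bool) (h : a = c → b = a) :
      Reidemeister [⟨i, .cross a⟩, ⟨i + 1, .cross b⟩, ⟨i, .cross c⟩]
        [⟨i + 1, .cross c⟩, ⟨i, .cross b⟩, ⟨i + 1, .cross a⟩]

/-- A local change in either direction. -/
def LocalMove (R R' : Diagram) : Prop :=
  PlanarIsotopy R R' ∨ PlanarIsotopy R' R ∨ Reidemeister R R' ∨ Reidemeister R' R

/-- A diagram together with a coloring. Only those obtained by moves from a coloring of a knot diagram
occur below; since moves change neither the number of components nor the knot type, their diagrams
are diagrams of the same knot. -/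
structure ColoredDiagram (X : Type*) [Quandle X] where
  diagram : Diagram
  coloring : Coloring X diagram

/-- The diagram and the coloring `E'` are obtained from `E` by one move, which replaces the part `R`
of the diagram by `R'`: the colors outside of this part stay the same. -/
def Move {X : Type*} [Quandle X] (E E' : ColoredDiagram X) : Prop :=
  ∃ (U R R' V : Diagram) (CU CR CR' CV : List (Level X)) (s t : Level X),
    LocalMove R R' ∧
    IsColoring [] U CU s ∧ IsColoring s R CR t ∧ IsColoring s R' CR' t ∧ IsColoring t V CV [] ∧
    E.diagram = U ++ R ++ V ∧ E.coloring.levels = CU ++ CR ++ CV ∧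
    E'.diagram = U ++ R' ++ V ∧ E'.coloring.levels = CU ++ CR' ++ CV

/-- `E'` is obtained from `E` by a finite sequence of Reidemeister moves and planar isotopies. -/
def ObtainedByMoves {X : Type*} [Quandle X] (E E' : ColoredDiagram X) : Prop :=
  Relation.ReflTransGen Move E E'

/-! ### The standard diagram of a torus knot -/

/-- The diagram `D(p, q)` of the `(p, q)`-torus knot as the closure of a braid with `|p|` strands.
At the bottom and the top, nested minima and maxima close up the braid. The braid consists of `|q|`
equal blocks; in each of them one outermost strand passes over all the others, from left to right
if `pq > 0` and from right to left if `pq < 0`. The strands of the braid are directed upwards if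
`pq > 0` and downwards if `pq < 0`, so all crossings have the sign of `pq`. -/
def torusDiagram (p q : ℤ) : Diagram :=
  (List.range p.natAbs).map (fun j => ⟨j, .cup (decide (0 < p * q))⟩) ++
  (List.range q.natAbs).flatMap (fun _ => (List.range (p.natAbs - 1)).map fun r =>
    ⟨if 0 < p * q then r else p.natAbs - 2 - r, .cross (decide (0 < p * q))⟩) ++
  (List.range p.natAbs).map (fun j => ⟨p.natAbs - 1 - j, .cap⟩)

/-! ### Regular polygons and trochoids -/

/-- `v` lists the vertices of a regular polygon of type `(m, k)`: with `v₀, …, v_{m-1}` the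
vertices of a convex regular `m`-gon in counterclockwise order, the `i`-th vertex is `v_{ik mod m}`.
Indices are integers and matter only modulo `m`. -/
def IsRegularPolygon (m k : ℕ) (v : ℤ → ℂ) : Prop :=
  ∃ c r : ℂ, r ≠ 0 ∧ ∀ i : ℤ, v i = c + r * Complex.exp (2 * Real.pi * Complex.I * (i * k) / m)

/-- The data of an `(m, k; n, l)`-trochoid: a regular polygon `Q` of type `(n, l)` with vertices
`v 0, v 1, …`, and a regular polygon `P₀` of type `(m, k)` with vertices `w 0, w 1, …`, with a
common first edge. -/
structure Trochoid where
  m : ℕ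
  k : ℕ
  n : ℕ
  l : ℕ
  hm : 2 ≤ m
  hn : 2 ≤ n
  hk : 1 ≤ k ∧ k ≤ m - 1
  hl : 1 ≤ l ∧ l ≤ n - 1
  v : ℤ → ℂ
  w : ℤ → ℂ
  regular_v : IsRegularPolygon n l v
  regular_w : IsRegularPolygon m k w
  start_zero : w 0 = v 0
  start_one : w 1 = v 1

namespace Trochoid

/-- The rotation angle `θ(m, k; n, l)`. -/
noncomputable def theta (T : Trochoid) : ℝ :=
  (((T.m : ℝ) - 2 * T.k) / T.m - ((T.n : ℝ) - 2 * T.l) / T.n) * Real.pi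

/-- `T.vertex i j` is the `j`-th vertex of the polygon `P_i`, where `P_{i+1}` is the image of
`P_i` under the rotation about the vertex `v (i+1)` of `Q` by the angle `θ`. -/
noncomputable def vertex (T : Trochoid) : ℕ → ℤ → ℂ
  | 0, j => T.w j
  | i + 1, j => (vertex T i j - T.v (i + 1)) * (Circle.exp T.theta : ℂ) + T.v (i + 1)

end Trochoid

namespace Trochoid

theorem exp_theta (T : Trochoid) : (Circle.exp T.theta : ℂ) *
    Complex.exp (2 * Real.pi * Complex.I * T.k / T.m) =
    Complex.exp (2 * Real.pi * Complex.I * T.l / T.n) := by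
  have hm : (T.m : ℂ) ≠ 0 := by have := T.hm; exact_mod_cast (by omega : T.m ≠ 0)
  have hn : (T.n : ℂ) ≠ 0 := by have := T.hn; exact_mod_cast (by omega : T.n ≠ 0)
  rw [Circle.coe_exp, ← Complex.exp_add]
  congr 1
  simp only [theta]
  push_cast
  field_simp
  ring

theorem exp_step (m k : ℕ) (i : ℤ) : Complex.exp (2 * Real.pi * Complex.I * (i * k) / m) =
    Complex.exp (2 * Real.pi * Complex.I * k / m) ^ i := by
  rw [← Complex.exp_int_mul]
  congr 1
  ring

theorem exp_pow_self {m : ℕ} (k : ℕ) (hm : m ≠ 0) :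
    Complex.exp (2 * Real.pi * Complex.I * k / m) ^ m = 1 := by
  have hm : (m : ℂ) ≠ 0 := by exact_mod_cast hm
  rw [← Complex.exp_nat_mul, Complex.exp_eq_one_iff]
  exact ⟨k, by push_cast; field_simp⟩

/-- A closed form of the trochoid: with `o` the center of `Q`, the polygon `P_i` is, up to the
naming of its vertices, `P₀` rotated about `o` by the angle `2πli/n`. -/
theorem exists_vertex_eq (T : Trochoid) : ∃ o : ℂ,
    (∀ (i : ℕ) (j : ℤ), T.vertex i j =
      o + (T.w (j - i) - o) * Complex.exp (2 * Real.pi * Complex.I * T.l / T.n) ^ i) ∧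
    (∀ i : ℤ, T.v i =
      o + (T.v 0 - o) * Complex.exp (2 * Real.pi * Complex.I * T.l / T.n) ^ i) := by
  obtain ⟨o, r, hr, hv⟩ := T.regular_v
  obtain ⟨o', r', hr', hw⟩ := T.regular_w
  have hζ := T.exp_theta
  have h0 := T.start_zero
  have h1 := T.start_one
  simp only [exp_step] at hv hw
  generalize hA : Complex.exp (2 * Real.pi * Complex.I * T.l / T.n) = A at *
  generalize hB : Complex.exp (2 * Real.pi * Complex.I * T.k / T.m) = B at *
  have hA0 : A ≠ 0 := hA ▸ Complex.exp_ne_zero _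
  have hB0 : B ≠ 0 := hB ▸ Complex.exp_ne_zero _
  rw [hv, hw] at h0 h1
  simp only [zpow_zero, mul_one, zpow_one] at h0 h1
  refine ⟨o, ?_, ?_⟩
  · intro i
    induction i with
    | zero => intro j; simp [vertex]
    | succ i ih =>
      intro j
      rw [vertex, ih, hw, hw, hv]
      have e1 : (j - (i : ℕ) : ℤ) = (j - ((i + 1 : ℕ) : ℤ)) + 1 := by push_cast; ring
      rw [e1, zpow_add₀ hB0, zpow_one]
      have e2 : A ^ ((i : ℤ) + 1) = A ^ (i + 1) := by exact_mod_cast zpow_natCast A (i + 1)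
      rw [e2]
      generalize B ^ (j - ((i + 1 : ℕ) : ℤ)) = C
      rw [← hζ] at h1 ⊢
      generalize (Circle.exp T.theta : ℂ) = z at *
      have h2 : o' - o = r - r' := by linear_combination h0
      have h3 : r - r' = r * (z * B) - r' * B := by linear_combination h1 - h0
      simp only [pow_succ]
      generalize (z * B) ^ i = D
      linear_combination (D * z * (1 - B)) * h2 + D * z * h3
  · intro i
    rw [hv, hv]
    simp

theorem vertex_self (T : Trochoid) (i : ℕ) : T.vertex i i = T.v i := by
  obtain ⟨o, h1, h2⟩ := T.exists_vertex_eq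
  rw [h1, h2 i, sub_self, T.start_zero, zpow_natCast]

theorem vertex_succ (T : Trochoid) (i : ℕ) : T.vertex i (i + 1) = T.v (i + 1) := by
  cases i with
  | zero => simpa [vertex] using T.start_one
  | succ i =>
    obtain ⟨o, h1, h2⟩ := T.exists_vertex_eq
    have h3 := h2 1
    rw [h1, h2, add_sub_cancel_left, T.start_one, h3, zpow_add₀ (Complex.exp_ne_zero _)]
    rw [zpow_natCast, zpow_one]
    ring

theorem w_periodic (T : Trochoid) (j : ℤ) : T.w (j + T.m) = T.w j := by
  obtain ⟨o', r', hr', hw⟩ := T.regular_w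
  have hm : T.m ≠ 0 := by have := T.hm; omega
  rw [hw, hw, exp_step, exp_step, zpow_add₀ (Complex.exp_ne_zero _), zpow_natCast,
    exp_pow_self _ hm, mul_one]

theorem vertex_periodic (T : Trochoid) (i : ℕ) (j : ℤ) :
    T.vertex i (j + T.m) = T.vertex i j := by
  induction i with
  | zero => exact T.w_periodic j
  | succ i ih => rw [vertex, vertex, ih]

theorem vertex_last (T : Trochoid) (j : ℤ) : T.vertex T.n (T.n + j) = T.w j := by
  obtain ⟨o, h1, h2⟩ := T.exists_vertex_eq
  have hn : T.n ≠ 0 := by have := T.hn; omega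
  rw [h1, exp_pow_self _ hn]
  simp

/-! ### Shifts and switches -/

/-- A shift: the trochoid around `Q` starting at `P₁` instead of `P₀`. -/
noncomputable def shift (T : Trochoid) : Trochoid where
  m := T.m
  k := T.k
  n := T.n
  l := T.l
  hm := T.hm
  hn := T.hn
  hk := T.hk
  hl := T.hl
  v i := T.v (i + 1)
  w j := T.vertex 1 (j + 1)
  regular_v := by
    obtain ⟨c, r, hr, hv⟩ := T.regular_v
    refine ⟨c, r * Complex.exp (2 * Real.pi * Complex.I * T.l / T.n),
      mul_ne_zero hr (Complex.exp_ne_zero _), fun i => ?_⟩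
    simp only [hv, exp_step]
    rw [zpow_add₀ (Complex.exp_ne_zero _), zpow_one]
    ring
  regular_w := by
    obtain ⟨c, r, hr, hw⟩ := T.regular_w
    refine ⟨(c - T.v 1) * (Circle.exp T.theta : ℂ) + T.v 1,
      r * Complex.exp (2 * Real.pi * Complex.I * T.k / T.m) * (Circle.exp T.theta : ℂ),
      mul_ne_zero (mul_ne_zero hr (Complex.exp_ne_zero _)) (Circle.coe_ne_zero _), fun i => ?_⟩
    simp only [vertex]
    rw [hw, exp_step, exp_step, zpow_add₀ (Complex.exp_ne_zero _), zpow_one]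
    simp only [Nat.cast_zero, zero_add]
    ring
  start_zero := by simpa using T.vertex_self 1
  start_one := by simpa using T.vertex_succ 1

theorem regular_reverse {m k : ℕ} (hm : m ≠ 0) (hk : k ≤ m) {v : ℤ → ℂ}
    (h : IsRegularPolygon m k v) : IsRegularPolygon m (m - k) fun i => v (1 - i) := by
  obtain ⟨c, r, hr, hv⟩ := h
  refine ⟨c, r * Complex.exp (2 * Real.pi * Complex.I * k / m),
    mul_ne_zero hr (Complex.exp_ne_zero _), fun i => ?_⟩
  have hm' : (m : ℂ) ≠ 0 := by exact_mod_cast hm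
  simp only [hv]
  rw [mul_assoc r, ← Complex.exp_add]
  congr 2
  rw [Complex.exp_eq_exp_iff_exists_int]
  refine ⟨-i, ?_⟩
  push_cast [Nat.cast_sub hk]
  field_simp
  ring

/-- A switch: the `(n, n - l; m, m - k)`-trochoid around `(w₁, w₀, w_{m-1}, …, w₂)` starting at
`(v₁, v₀, v_{n-1}, …, v₂)`. -/
noncomputable def switch (T : Trochoid) : Trochoid where
  m := T.n
  k := T.n - T.l
  n := T.m
  l := T.m - T.k
  hm := T.hn
  hn := T.hm
  hk := by have := T.hl; have := T.hn; omega
  hl := by have := T.hk; have := T.hm; omega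
  v i := T.w (1 - i)
  w j := T.v (1 - j)
  regular_v := regular_reverse (by have := T.hm; omega) (by have := T.hk; omega) T.regular_w
  regular_w := regular_reverse (by have := T.hn; omega) (by have := T.hl; omega) T.regular_v
  start_zero := by simpa using T.start_one.symm
  start_one := by simpa using T.start_zero.symm

/-- `T.Deforms s T'`: the trochoid `T'` is obtained from `T` by finitely many shifts and switches,
and `s` is the number of the switches. -/
inductive Deforms (T : Trochoid) : ℕ → Trochoid → Prop
  | refl : Deforms T 0 T
  | shift {s : ℕ} {T' : Trochoid} : Deforms T s T' → Deforms T s T'.shift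
  | switch {s : ℕ} {T' : Trochoid} : Deforms T s T' → Deforms T (s + 1) T'.switch

/-! ### The coloring derived from a trochoid -/

/-- The color of the arc `a_{ij}` of `D(p, q)`. -/
noncomputable def color (T : Trochoid) (i : ℕ) (j : ℕ) : RotE2 :=
  ⟨T.vertex i (i + j + 1), Circle.exp T.theta⟩

open scoped Quandles in
/-- The condition for a coloring where `a_{i0}` passes over `a_{i,j+1}`, which continues as
`a_{i+1,j}`. -/
theorem color_act (T : Trochoid) (i j : ℕ) :
    T.color i 0 ◃ T.color i (j + 1) = T.color (i + 1) j := by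
  ext
  · simp only [color, Shelf.act]
    have h := T.vertex_succ i
    push_cast
    rw [add_zero, h, vertex]
    congr 4
    ring
  · rfl

/-- `a_{i0}` and `a_{i+1,|p|-1}` are the same arc. -/
theorem color_over (T : Trochoid) (i : ℕ) :
    T.color i 0 = T.color (i + 1) (T.m - 1) := by
  have hm := T.hm
  ext
  · simp only [color]
    have h := T.vertex_self (i + 1)
    have e : ((i + 1 : ℕ) : ℤ) + ((T.m - 1 : ℕ) : ℤ) + 1 = ((i + 1 : ℕ) : ℤ) + T.m := by
      omega
    rw [e, vertex_periodic, h]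
    push_cast
    rw [add_zero, T.vertex_succ i]
  · rfl

/-- The last row of arcs is the first one. -/
theorem color_last (T : Trochoid) (j : ℕ) : T.color T.n j = T.color 0 j := by
  ext
  · simp only [color]
    rw [add_assoc, vertex_last]
    simp [vertex]
  · rfl

/-- The colors of the strands of the braid in the `i`-th block after the first `r` crossings, in
the order in which the over strand meets them: `a_{i+1,0}, …, a_{i+1,r-1}` (after the crossings), the
over strand `a_{i0}`, and `a_{i,r+1}, …, a_{i,|p|-1}` (before the crossings). -/
noncomputable def row (T : Trochoid) (i r : ℕ) : List RotE2 :=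
  (List.range r).map (T.color (i + 1)) ++
    T.color i 0 :: (List.range' (r + 1) (T.m - 1 - r)).map (T.color i)

/-- The strands of the braid, from left to right, in the `i`-th block after the first `r` crossings.
Here `o = true` is the case `pq > 0`. -/
noncomputable def braidLevel (T : Trochoid) (o : Bool) (i r : ℕ) : Level RotE2 :=
  (if o = true then T.row i r else (T.row i r).reverse).map (Strand.mk o)

/-- The strands, in the reverse order and direction, which close up the given strands. -/
def closing {X : Type*} (s : Level X) : Level X :=
  s.reverse.map fun a => ⟨!a.up, a.color⟩

/-- The outermost `r` strands of the closed braid, together with the strands closing them up. -/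
noncomputable def nestedLevel (T : Trochoid) (o : Bool) (r : ℕ) : Level RotE2 :=
  (T.braidLevel o 0 0).take r ++ closing ((T.braidLevel o 0 0).take r)

/-- All colored levels of `D(p, q)`, from bottom to top. -/
noncomputable def levels (T : Trochoid) (o : Bool) : List (Level RotE2) :=
  (List.range T.m).map (fun r => T.nestedLevel o (r + 1)) ++
  (List.range T.n).flatMap (fun i => (List.range (T.m - 1)).map fun r =>
    T.braidLevel o i (r + 1) ++ closing (T.braidLevel o 0 0)) ++
  (List.range T.m).map (fun r => T.nestedLevel o (T.m - 1 - r))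

end Trochoid

section Chains

variable {X : Type*} [Quandle X]

theorem IsColoring.append {s t u : Level X} {D D' : Diagram} {C C' : List (Level X)}
    (h : IsColoring s D C t) (h' : IsColoring t D' C' u) :
    IsColoring s (D ++ D') (C ++ C') u := by
  induction D generalizing s C with
  | nil =>
    cases C with
    | nil => cases h; exact h'
    | cons _ _ => exact h.elim
  | cons P D ih =>
    cases C with
    | nil => exact h.elim
    | cons a C => exact ⟨h.1, ih h.2⟩

theorem IsColoring.of_flatMap (f : ℕ → Level X) (D : ℕ → Diagram) (C : ℕ → List (Level X))
    (N : ℕ) (h : ∀ r < N, IsColoring (f r) (D r) (C r) (f (r + 1))) :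
    IsColoring (f 0) ((List.range N).flatMap D) ((List.range N).flatMap C) (f N) := by
  induction N with
  | zero => rfl
  | succ N ih =>
    simp only [List.range_succ, List.flatMap_append, List.flatMap_singleton]
    exact (ih fun r hr => h r (by omega)).append (h N (by omega))

theorem IsColoring.of_map (f : ℕ → Level X) (P : ℕ → Piece) (N : ℕ)
    (h : ∀ r < N, (P r).Colored (f r) (f (r + 1))) :
    IsColoring (f 0) ((List.range N).map P) ((List.range N).map fun r => f (r + 1)) (f N) := by
  induction N with
  | zero => rfl
  | succ N ih =>
    simp only [List.range_succ, List.map_append, List.map_singleton]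
    exact (ih fun r hr => h r (by omega)).append ⟨h N (by omega), rfl⟩

theorem Piece.Colored.right {P : Piece} {s t : Level X} (h : P.Colored s t) (R : Level X) :
    P.Colored (s ++ R) (t ++ R) := by
  obtain ⟨L, A, B, R', hL, hP, rfl, rfl⟩ := h
  exact ⟨L, A, B, R' ++ R, hL, hP, by simp, by simp⟩

theorem Trochoid.cup_colored (s : Level X) (o : Bool) (hs : ∀ a ∈ s, a.up = o) (r : ℕ)
    (hr : r < s.length) :
    (Piece.mk r (.cup o)).Colored (s.take r ++ Trochoid.closing (s.take r))
      (s.take (r + 1) ++ Trochoid.closing (s.take (r + 1))) := by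
  refine ⟨s.take r, [], [⟨o, s[r].color⟩, ⟨!o, s[r].color⟩], Trochoid.closing (s.take r),
    by simp; omega, .cup _ _, by simp, ?_⟩
  have h : s[r].up = o := hs _ (List.getElem_mem hr)
  have e : s.take (r + 1) = s.take r ++ [s[r]] := by
    rw [List.take_add_one, List.getElem?_eq_getElem hr, Option.toList_some]
  rw [e, ← h]
  simp only [Trochoid.closing, List.reverse_append, List.reverse_singleton, List.map_cons,
    List.append_assoc, List.cons_append, List.nil_append]

theorem Trochoid.cap_colored (s : Level X) (o : Bool) (hs : ∀ a ∈ s, a.up = o) (r : ℕ)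
    (hr : r < s.length) :
    (Piece.mk r .cap).Colored (s.take (r + 1) ++ Trochoid.closing (s.take (r + 1)))
      (s.take r ++ Trochoid.closing (s.take r)) := by
  refine ⟨s.take r, [⟨o, s[r].color⟩, ⟨!o, s[r].color⟩], [], Trochoid.closing (s.take r),
    by simp; omega, .cap _ _, ?_, by simp⟩
  have h : s[r].up = o := hs _ (List.getElem_mem hr)
  have e : s.take (r + 1) = s.take r ++ [s[r]] := by
    rw [List.take_add_one, List.getElem?_eq_getElem hr, Option.toList_some]
  rw [e, ← h]
  simp only [Trochoid.closing, List.reverse_append, List.reverse_singleton, List.map_cons,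
    List.append_assoc, List.cons_append, List.nil_append]

end Chains

namespace Trochoid

theorem row_length (T : Trochoid) (i r : ℕ) (hr : r ≤ T.m - 1) : (T.row i r).length = T.m := by
  have := T.hm
  simp [row]
  omega

theorem row_next (T : Trochoid) (i : ℕ) : T.row i (T.m - 1) = T.row (i + 1) 0 := by
  have hm := T.hm
  have h : T.m - 1 = (T.m - 2) + 1 := by omega
  have e : T.row i (T.m - 1) = (List.range T.m).map (T.color (i + 1)) := by
    have : List.range T.m = List.range (T.m - 1) ++ [T.m - 1] := by
      rw [← List.range_succ]; congr 1; omega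
    rw [this]
    simp [row, T.color_over i]
  have e' : List.range T.m = 0 :: List.range' 1 (T.m - 1) := by
    rw [List.range_eq_range', show T.m = (T.m - 1) + 1 by omega, List.range'_succ]
    simp
  rw [e, e']
  simp [row]

theorem row_last (T : Trochoid) : T.row T.n 0 = T.row 0 0 := by
  simp only [row, List.range_zero, List.map_nil, List.nil_append, color_last]
  congr 1
  exact List.map_congr_left fun j _ => T.color_last j

theorem row_split (T : Trochoid) (i r : ℕ) (hr : r < T.m - 1) :
    ∃ A B : List RotE2, A.length = r ∧ B.length = T.m - 2 - r ∧
      T.row i r = A ++ T.color i 0 :: T.color i (r + 1) :: B ∧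
      T.row i (r + 1) = A ++ T.color (i + 1) r :: T.color i 0 :: B := by
  refine ⟨(List.range r).map (T.color (i + 1)),
    (List.range' (r + 2) (T.m - 2 - r)).map (T.color i), by simp, by simp, ?_, ?_⟩
  · rw [row, show T.m - 1 - r = (T.m - 2 - r) + 1 by omega, List.range'_succ]
    simp
  · rw [row, show T.m - 1 - (r + 1) = T.m - 2 - r by omega, List.range_succ]
    simp

theorem braid_colored (T : Trochoid) (o : Bool) (i r : ℕ) (hr : r < T.m - 1) :
    (Piece.mk (if o = true then r else T.m - 2 - r) (.cross o)).Colored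
      (T.braidLevel o i r) (T.braidLevel o i (r + 1)) := by
  obtain ⟨A, B, hA, hB, h1, h2⟩ := T.row_split i r hr
  rw [braidLevel, braidLevel, h1, h2, ← T.color_act]
  cases o with
  | true =>
    exact ⟨A.map (Strand.mk true), _, _, B.map (Strand.mk true), by simp [hA],
      .overRightUp true (T.color i (r + 1)) (T.color i 0), by simp, by simp⟩
  | false =>
    exact ⟨B.reverse.map (Strand.mk false), _, _, A.reverse.map (Strand.mk false), by simp [hB],
      .overLeftDown false (T.color i (r + 1)) (T.color i 0), by simp, by simp⟩

theorem levels_valid (T : Trochoid) (p q : ℤ) (hp : T.m = p.natAbs) (hq : T.n = q.natAbs) :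
    IsColoring [] (torusDiagram p q) (T.levels (decide (0 < p * q))) [] := by
  have hm := T.hm
  have hif : ∀ r, (if 0 < p * q then r else p.natAbs - 2 - r) =
      if decide (0 < p * q) = true then r else T.m - 2 - r := by
    intro r; rw [hp]; simp
  simp only [torusDiagram, hif]
  generalize decide (0 < p * q) = o
  rw [← hp, ← hq]
  have hl : (T.braidLevel o 0 0).length = T.m := by
    have := T.row_length 0 0 (by omega)
    cases o <;> simp [braidLevel, this]
  have hs : ∀ a ∈ T.braidLevel o 0 0, a.up = o := by
    intro a ha
    simp only [braidLevel, List.mem_map] at ha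
    obtain ⟨_, _, rfl⟩ := ha
    rfl
  have e0 : T.nestedLevel o 0 = [] := by simp [nestedLevel, closing]
  have em : T.nestedLevel o T.m = T.braidLevel o 0 0 ++ closing (T.braidLevel o 0 0) := by
    rw [nestedLevel, List.take_of_length_le (by omega)]
  refine IsColoring.append (t := T.nestedLevel o T.m)
    (IsColoring.append (t := T.nestedLevel o T.m) ?_ ?_) ?_
  · have := IsColoring.of_map (fun r => T.nestedLevel o r) (fun j => ⟨j, .cup o⟩) T.m
      (fun r hr => cup_colored _ o hs r (by omega))
    rwa [e0] at this
  · have h := IsColoring.of_flatMap (fun i => T.braidLevel o i 0 ++ closing (T.braidLevel o 0 0))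
      (fun _ => (List.range (T.m - 1)).map fun r =>
        ⟨if o = true then r else T.m - 2 - r, .cross o⟩)
      (fun i => (List.range (T.m - 1)).map fun r =>
        T.braidLevel o i (r + 1) ++ closing (T.braidLevel o 0 0)) T.n ?_
    · have hlast : T.braidLevel o T.n 0 = T.braidLevel o 0 0 := by
        simp only [braidLevel, row_last]
      simp only [hlast, ← em] at h
      exact h
    · intro i _
      have h := IsColoring.of_map
        (fun r => T.braidLevel o i r ++ closing (T.braidLevel o 0 0))
        (fun r => ⟨if o = true then r else T.m - 2 - r, .cross o⟩) (T.m - 1)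
        (fun r hr => (T.braid_colored o i r hr).right _)
      have hn : T.braidLevel o i (T.m - 1) = T.braidLevel o (i + 1) 0 := by
        simp only [braidLevel, row_next]
      simp only [hn] at h
      exact h
  · have := IsColoring.of_map (fun r => T.nestedLevel o (T.m - r))
      (fun j => ⟨T.m - 1 - j, .cap⟩) T.m (fun r hr => by
        have h := cap_colored _ o hs (T.m - 1 - r) (by omega)
        have e1 : T.m - r = T.m - 1 - r + 1 := by omega
        have e2 : T.m - (r + 1) = T.m - 1 - r := by omega
        simp only [nestedLevel, e1, e2]
        exact h)
    have e3 : (fun r => T.nestedLevel o (T.m - (r + 1))) =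
        fun r => T.nestedLevel o (T.m - 1 - r) := by
      funext r; congr 1; omega
    rw [e3] at this
    simp only [Nat.sub_self, e0, Nat.sub_zero] at this
    exact this

/-- The coloring of `D(p, q)` derived from the `(|p|, k; |q|, l)`-trochoid `T`. -/
noncomputable def coloring (T : Trochoid) (p q : ℤ) (hp : T.m = p.natAbs) (hq : T.n = q.natAbs) :
    Coloring RotE2 (torusDiagram p q) :=
  ⟨T.levels (decide (0 < p * q)), T.levels_valid p q hp hq⟩

/-! ### The sets of points -/

/-- The points which are used as the first component of a color by some coloring of `D(p, q)`
obtained from the one derived from `T` by shifts and an even number of switches. -/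
def pointsByDeformations (T : Trochoid) (p q : ℤ) : Set ℂ :=
  {z | ∃ (s : ℕ) (T' : Trochoid) (hp : T'.m = p.natAbs) (hq : T'.n = q.natAbs),
    Even s ∧ T.Deforms s T' ∧ ∃ x : RotE2, (T'.coloring p q hp hq).Uses x ∧ x.center = z}

/-- The points which are used as the first component of a color by some coloring of some diagram
obtained from the coloring `C` by a finite sequence of Reidemeister moves and planar isotopies. -/
def _root_.Coloring.pointsByMoves {D : Diagram} (C : Coloring RotE2 D) : Set ℂ :=
  {z | ∃ E : ColoredDiagram RotE2, ObtainedByMoves ⟨D, C⟩ E ∧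
    ∃ x : RotE2, E.coloring.Uses x ∧ x.center = z}

/-- The number `α`: with `p' = m / gcd(m, k)` and `q' = n / gcd(n, l)`, it is `p'q'/2` if `p'q'` is
even and `p'q'` otherwise. -/
def alpha (T : Trochoid) : ℕ :=
  let N := T.m / Nat.gcd T.m T.k * (T.n / Nat.gcd T.n T.l)
  if Even N then N / 2 else N

/-- The complex number `v_σ` of absolute value `1`. -/
noncomputable def direction (T : Trochoid) (σ : ℕ) : ℂ :=
  let t : ℝ := Complex.arg (T.vertex 0 1 - T.vertex 0 0) + σ * Real.pi / T.alpha
  Real.cos t + Complex.I * Real.sin t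

end Trochoid

/-! Write ρ = exp(iθ) and d = w₀₁ - w₀₀. The quotients of successive edges of P₀ and of Q are roots
of unity of the coprime orders p' and q', and ρ is the second divided by the first, hence a
primitive p'q'-th root of unity. All three sets of the theorem equal `lattice`, the set w₀₀ + d
ℤ[ρ].

Explicit description (`lattice_eq`): ℤ[ρ] is also generated by ζ = exp(iπ/α), since ζ or -ζ is a
p'q'-th root of unity, and v_σ = d ζ^σ because |d| = 1.

Upper bound for moves (`pointsByMoves_subset`): the rotations by θ with center in the lattice are
closed under the quandle operation and its inverse, and a move creates only colors generated by
those already present.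

Lower bound for moves (`subset_pointsByMoves`): a horizontal line through the closed braid meets
strands in nested, oppositely directed pairs, so passing under all of them changes no color. Hence a
strand can travel under all the others and return over them, which acts on all colors by its own
rotation. Second Reidemeister moves insert such a braid followed by its inverse. The rotations about
w₀₀ and w₀₁ thereby yield the translation by d(1 - ρ), and conjugation multiplies translations by ρ.
As p'q' is a product of coprime factors greater than 1, 1 - ρ is a unit of ℤ[ρ]
(`IsPrimitiveRoot.exists_one_sub_mul_eq_one`), so all translations by d ℤ[ρ] occur.

Deformations: a shift steps the common edge along Q, and a shift conjugated by switches steps it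
back along P₀. Together they rotate the edge about its starting point by θ. Iterating this restores
the direction after each step, so the edge can be translated by every element of d ℤ[ρ]
(`Reaches.add_mul`). -/

/-! ### Braids acting on the colors of a level -/

section Braiding

open scoped Quandles

variable {X : Type*}

/-- Apply a map to the color of a strand. -/
def Strand.recolor (φ : X → X) (a : Strand X) : Strand X := ⟨a.up, φ a.color⟩

/-- Apply a map to all colors of a level. -/
def Level.recolor (φ : X → X) (s : Level X) : Level X := s.map (Strand.recolor φ)

theorem Level.recolor_recolor (φ ψ : X → X) (s : Level X) :
    Level.recolor φ (Level.recolor ψ s) = Level.recolor (fun x => φ (ψ x)) s := by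
  simp only [Level.recolor, List.map_map]
  rfl

variable [Quandle X]

/-- The change of the color of a strand that passes to the right under the strand `a`. -/
def Strand.pass (a : Strand X) : Equiv.Perm X :=
  if a.up = true then (Rack.act' a.color)⁻¹ else Rack.act' a.color

/-- Two levels which are separated by a single crossing. -/
def Swap (s t : Level X) : Prop := ∃ (i : ℕ) (b : Bool), (Piece.mk i (.cross b)).Colored s t

/-- Two levels which are separated by a braid. -/
abbrev Braided : Level X → Level X → Prop := Relation.ReflTransGen Swap

theorem Shape.Colored.cross_symm {b : Bool} {s t : Level X}
    (h : Shape.Colored (.cross b) s t) : Shape.Colored (.cross (!b)) t s := by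
  cases h with
  | overRightUp o x y => exact .overLeftUp o x y
  | overRightDown o x y => exact .overLeftDown o x y
  | overLeftUp o x y => exact .overRightUp o x y
  | overLeftDown o x y => exact .overRightDown o x y

theorem Piece.Colored.cross_symm {i : ℕ} {b : Bool} {s t : Level X}
    (h : (Piece.mk i (.cross b)).Colored s t) : (Piece.mk i (.cross (!b))).Colored t s := by
  obtain ⟨L, A, B, R, hL, hP, rfl, rfl⟩ := h
  exact ⟨L, B, A, R, hL, hP.cross_symm, rfl, rfl⟩

theorem Swap.symm {s t : Level X} : Swap s t → Swap t s := by
  rintro ⟨i, b, h⟩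
  exact ⟨i, !b, h.cross_symm⟩

theorem Braided.symm {s t : Level X} (h : Braided s t) : Braided t s := by
  induction h with
  | refl => exact .refl
  | tail _ h ih => exact .head h.symm ih

theorem Swap.append {s t : Level X} (h : Swap s t) (L R : Level X) :
    Swap (L ++ s ++ R) (L ++ t ++ R) := by
  obtain ⟨i, b, L', A, B, R', hL, hP, rfl, rfl⟩ := h
  exact ⟨L.length + i, b, L ++ L', A, B, R' ++ R, by simp [hL], hP, by simp, by simp⟩

theorem Braided.append {s t : Level X} (h : Braided s t) (L R : Level X) :
    Braided (L ++ s ++ R) (L ++ t ++ R) :=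
  Relation.ReflTransGen.lift (fun s => L ++ s ++ R) (fun _ _ h => Swap.append h L R) s t h

theorem Swap.recolor {s t : Level X} (h : Swap s t) {φ : X → X}
    (hφ : ∀ x y, φ (x ◃ y) = φ x ◃ φ y) :
    Swap (Level.recolor φ s) (Level.recolor φ t) := by
  obtain ⟨i, b, L, A, B, R, hL, hP, rfl, rfl⟩ := h
  refine ⟨i, b, L.map (Strand.recolor φ), A.map (Strand.recolor φ), B.map (Strand.recolor φ),
    R.map (Strand.recolor φ), by simpa using hL, ?_, by simp [Level.recolor],
    by simp [Level.recolor]⟩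
  cases hP with
  | overRightUp o x y => simpa [Strand.recolor, hφ] using .overRightUp o (φ x) (φ y)
  | overRightDown o x y => simpa [Strand.recolor, hφ] using .overRightDown o (φ x) (φ y)
  | overLeftUp o x y => simpa [Strand.recolor, hφ] using .overLeftUp o (φ x) (φ y)
  | overLeftDown o x y => simpa [Strand.recolor, hφ] using .overLeftDown o (φ x) (φ y)

theorem Braided.recolor {s t : Level X} (h : Braided s t) {φ : X → X}
    (hφ : ∀ x y, φ (x ◃ y) = φ x ◃ φ y) :
    Braided (Level.recolor φ s) (Level.recolor φ t) :=
  Relation.ReflTransGen.lift _ (fun _ _ h => Swap.recolor h hφ) s t h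

theorem Swap.pass (x a : Strand X) : Swap [x, a] [a, x.recolor a.pass] := by
  obtain ⟨u, y⟩ := a
  obtain ⟨o, x⟩ := x
  refine ⟨0, false, [], _, _, [], rfl, ?_, by simp; rfl, by simp; rfl⟩
  cases u with
  | true =>
    have := Shape.Colored.overLeftUp o (y ◃⁻¹ x) y
    rwa [Rack.right_inv] at this
  | false => exact .overLeftDown o x y

theorem Braided.under (x : Strand X) (s : Level X) :
    Braided (x :: s) (s ++ [x.recolor fun y => s.foldl (fun y a => a.pass y) y]) := by
  induction s generalizing x with
  | nil => exact .refl
  | cons a s ih =>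
    have h1 := Relation.ReflTransGen.single ((Swap.pass x a).append [] s)
    have h2 := (ih (x.recolor a.pass)).append [a] []
    simp only [List.append_nil] at h2
    exact h1.trans h2

theorem Braided.over (x : Strand X) (s : Level X) :
    Braided (s ++ [x]) (x :: Level.recolor x.pass s) := by
  induction s with
  | nil => exact .refl
  | cons a s ih =>
    have h1 := ih.append [a] []
    have h2 := Relation.ReflTransGen.single
      ((Swap.pass a x).append [] (Level.recolor x.pass s))
    simp only [List.append_nil] at h1
    exact h1.trans h2

theorem Quandle.inv_act {φ : Equiv.Perm X} (hφ : ∀ x y, φ (x ◃ y) = φ x ◃ φ y) (x y : X) :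
    φ⁻¹ (x ◃ y) = φ⁻¹ x ◃ φ⁻¹ y :=
  φ.injective (by simp [hφ])

theorem Strand.pass_act (a : Strand X) (x y : X) :
    a.pass (x ◃ y) = a.pass x ◃ a.pass y := by
  obtain ⟨u, z⟩ := a
  cases u with
  | true => exact Quandle.inv_act (φ := Rack.act' z) (fun _ _ => Shelf.self_distrib) x y
  | false => exact Shelf.self_distrib

theorem Strand.pass_color (a : Strand X) : a.pass a.color = a.color := by
  obtain ⟨u, z⟩ := a
  cases u with
  | true => exact Quandle.fix_inv
  | false => exact Quandle.fix

/-- A strand that passes under all strands of a closed level keeps its color. -/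
def Level.Closed (s : Level X) : Prop := ∀ y, s.foldl (fun y a => a.pass y) y = y

theorem Level.Closed.rotate {a : Strand X} {s : Level X} (h : Level.Closed (a :: s)) :
    Level.Closed (s ++ [a]) := by
  intro y
  have := h (a.pass⁻¹ y)
  have e : a.pass (a.pass⁻¹ y) = y := by simp
  rw [List.foldl_cons, e] at this
  simp [List.foldl_append, this]

theorem Level.Closed.rotate_append {s t : Level X} (h : Level.Closed (s ++ t)) :
    Level.Closed (t ++ s) := by
  induction s generalizing t with
  | nil => simpa using h
  | cons a s ih =>
    have h1 : Level.Closed (s ++ t ++ [a]) := Level.Closed.rotate h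
    have := ih (t := t ++ [a]) (by simpa using h1)
    simpa using this

/-- The strand `a` passes under all the others. A turn under the whole level is trivial, and `a`
fixes its own color, so `a` arrives at the right end uncolored by the trip: its color is the old
one. -/
theorem Level.Closed.braided_rotate {a : Strand X} {s : Level X} (h : Level.Closed (a :: s)) :
    Braided (a :: s) (s ++ [a]) := by
  have h1 := Braided.under a s
  have h2 := h a.color
  simp only [List.foldl_cons, a.pass_color] at h2
  simpa only [Strand.recolor, h2] using h1

theorem Level.Closed.braided_rotate_append {s t : Level X} (h : Level.Closed (s ++ t)) :
    Braided (s ++ t) (t ++ s) := by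
  induction s generalizing t with
  | nil => simpa using Relation.ReflTransGen.refl
  | cons a s ih =>
    have h0 : Level.Closed (a :: (s ++ t)) := by simpa using h
    have h1 := h0.braided_rotate
    have h2 := ih (t := t ++ [a]) (by simpa using h0.rotate)
    simp only [List.append_assoc, List.cons_append, List.nil_append] at h1 h2 ⊢
    exact h1.trans h2

/-- Rotate the level until `a` is leftmost, send `a` under everything to the right end and back over
everything to the left end. The way out changes no color, the way back applies `a.pass` to all of
them. Undoing the rotation with the recolored braid restores the order of the strands. -/
theorem Level.Closed.braided_pass {s : Level X} (h : Level.Closed s) {a : Strand X}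
    (ha : a ∈ s) : Braided s (Level.recolor a.pass s) := by
  obtain ⟨L, R, rfl⟩ := List.append_of_mem ha
  have h1 := h.braided_rotate_append
  have h2 := (by simpa using h.rotate_append : Level.Closed (a :: (R ++ L))).braided_rotate
  have h3 := Braided.over a (R ++ L)
  have h4 := h1.recolor a.pass_act
  have e : a.recolor a.pass = a := by simp [Strand.recolor, a.pass_color]
  have h5 : Braided (L ++ a :: R) (Level.recolor a.pass (a :: R ++ L)) := by
    refine h1.trans ((h2.trans h3).trans ?_)
    simp only [Level.recolor, List.cons_append, List.map_cons, e]
    exact .refl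
  exact h5.trans h4.symm

/-- The automorphisms of the quandle which change the colors of a level in the same way as some
braid does. -/
def Level.monodromy (s : Level X) : Subgroup (Equiv.Perm X) where
  carrier := {φ | (∀ x y, φ (x ◃ y) = φ x ◃ φ y) ∧ Braided s (Level.recolor φ s)}
  one_mem' := ⟨fun _ _ => rfl, by
    have : Level.recolor (1 : Equiv.Perm X) s = s := List.map_id s
    rw [this]⟩
  mul_mem' := by
    rintro φ ψ ⟨h1, h2⟩ ⟨h3, h4⟩
    -- The braid for `φ` comes first; the braid for `ψ`, recolored by the automorphism `φ`,
    -- continues it.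
    refine ⟨fun x y => by simp [h1, h3], h2.trans ?_⟩
    have := h4.recolor h1
    rwa [Level.recolor_recolor] at this
  inv_mem' := by
    rintro φ ⟨h1, h2⟩
    have h3 := Quandle.inv_act h1
    refine ⟨h3, ?_⟩
    have := (h2.recolor h3).symm
    simpa [Level.recolor, Function.comp_def, Strand.recolor] using this

theorem Level.Closed.act_mem_monodromy {s : Level X} (h : Level.Closed s) {a : Strand X}
    (ha : a ∈ s) : Rack.act' a.color ∈ Level.monodromy s := by
  have h1 : a.pass ∈ Level.monodromy s := ⟨a.pass_act, h.braided_pass ha⟩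
  unfold Strand.pass at h1
  split_ifs at h1
  · simpa using h1
  · exact h1

/-- The level consists of nested pairs of strands with equal colors and opposite directions. The
innermost pairs cancel first. -/
theorem Level.closed_append_closing (s : Level X) : Level.Closed (s ++ Trochoid.closing s) := by
  induction s with
  | nil => exact fun _ => rfl
  | cons a s ih =>
    intro y
    have e : a :: s ++ Trochoid.closing (a :: s) =
        a :: (s ++ Trochoid.closing s ++ [⟨!a.up, a.color⟩]) := by
      simp [Trochoid.closing]
    rw [e, List.foldl_cons, List.foldl_append, ih]
    cases h : a.up <;> simp [Strand.pass, h]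

end Braiding

/-! ### Realizing braids by Reidemeister moves -/

section Moves

open scoped Quandles

variable {X : Type*} [Quandle X]

/-- A horizontal line in general position meets the colored diagram in the level `s`. -/
def ColoredDiagram.Meets (E : ColoredDiagram X) (s : Level X) : Prop :=
  ∃ (U V : Diagram) (CU CV : List (Level X)), IsColoring [] U CU s ∧ IsColoring s V CV [] ∧
    E.diagram = U ++ V ∧ E.coloring.levels = CU ++ CV

theorem IsColoring.last_mem {s t : Level X} {D : Diagram} {C : List (Level X)}
    (h : IsColoring s D C t) : t = s ∨ t ∈ C := by
  induction D generalizing s C with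
  | nil =>
    cases C with
    | nil => exact .inl h.symm
    | cons _ _ => exact h.elim
  | cons P D ih =>
    cases C with
    | nil => exact h.elim
    | cons u C => rcases ih h.2 with rfl | h <;> simp_all

theorem ColoredDiagram.Meets.uses {E : ColoredDiagram X} {s : Level X} (h : E.Meets s)
    {a : Strand X} (ha : a ∈ s) : E.coloring.Uses a.color := by
  obtain ⟨U, V, CU, CV, h1, h2, h3, h4⟩ := h
  rcases h1.last_mem with rfl | h5
  · simp at ha
  · exact ⟨s, by simp [h4, h5], a, ha, rfl⟩

/-- A second Reidemeister move inserts the crossing and its inverse at the level `s`; the line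
between the two crossings meets the diagram in `t`. -/
theorem ColoredDiagram.Meets.swap {E : ColoredDiagram X} {s t : Level X} (h : E.Meets s)
    (hst : Swap s t) : ∃ E' : ColoredDiagram X, Move E E' ∧ E'.Meets t := by
  obtain ⟨U, V, CU, CV, h1, h2, h3, h4⟩ := h
  obtain ⟨i, b, h5⟩ := hst
  have h6 : IsColoring s [⟨i, .cross b⟩, ⟨i, .cross (!b)⟩] [t, s] s := ⟨h5, h5.cross_symm, rfl⟩
  refine ⟨⟨U ++ [⟨i, .cross b⟩, ⟨i, .cross (!b)⟩] ++ V, ⟨CU ++ [t, s] ++ CV,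
    (h1.append h6).append h2⟩⟩, ⟨U, [], _, V, CU, [], [t, s], CV, s, s,
      .inr (.inr (.inr (.two i b))), h1, rfl, h6, h2, by simpa using h3, by simpa using h4,
      rfl, rfl⟩, U ++ [⟨i, .cross b⟩], ⟨i, .cross (!b)⟩ :: V, CU ++ [t], s :: CV,
      h1.append ⟨h5, rfl⟩, ⟨h5.cross_symm, h2⟩, by simp, by simp⟩

theorem ColoredDiagram.Meets.braided {E : ColoredDiagram X} {s t : Level X} (h : E.Meets s)
    (hst : Braided s t) : ∃ E' : ColoredDiagram X, ObtainedByMoves E E' ∧ E'.Meets t := by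
  induction hst with
  | refl => exact ⟨E, .refl, h⟩
  | tail _ h2 ih =>
    obtain ⟨E1, h3, h4⟩ := ih
    obtain ⟨E2, h5, h6⟩ := h4.swap h2
    exact ⟨E2, h3.tail h5, h6⟩

end Moves

/-! ### Moves stay within a set of colors closed under the operations -/

section Invariance

open scoped Quandles

variable {X : Type*} [Quandle X]

/-- All strands of the level have a color in `K`. -/
def Level.ColorsIn (K : Set X) (s : Level X) : Prop := ∀ a ∈ s, a.color ∈ K

/-- The set of colors `K` is closed under the quandle operation and its inverse. -/
structure ActClosed (K : Set X) : Prop where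
  act : ∀ x ∈ K, ∀ y ∈ K, y ◃ x ∈ K
  invAct : ∀ x ∈ K, ∀ y ∈ K, y ◃⁻¹ x ∈ K

theorem ActClosed.mem_of_act {K : Set X} (hK : ActClosed K) {x y : X} (hy : y ∈ K)
    (h : y ◃ x ∈ K) : x ∈ K := by
  simpa using hK.invAct _ h _ hy

theorem Level.ColorsIn.of_cross {K : Set X} (hK : ActClosed K) {i : ℕ} {b : Bool}
    {s t : Level X} (h : (Piece.mk i (.cross b)).Colored s t) (hs : Level.ColorsIn K s) :
    Level.ColorsIn K t := by
  obtain ⟨L, A, B, R, hL, hP, rfl, rfl⟩ := h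
  have h1 : ∀ a ∈ A, a.color ∈ K := fun a ha => hs a (by simp [ha])
  have h2 : ∀ a ∈ B, a.color ∈ K := by
    cases hP with
    | overRightUp o x y => simpa using ⟨hK.act _ (by simp_all) _ (by simp_all), by simp_all⟩
    | overRightDown o x y =>
      simp only [List.mem_cons, List.not_mem_nil, or_false, forall_eq_or_imp, forall_eq] at h1 ⊢
      exact ⟨hK.mem_of_act h1.1 h1.2, h1.1⟩
    | overLeftUp o x y =>
      simp only [List.mem_cons, List.not_mem_nil, or_false, forall_eq_or_imp, forall_eq] at h1 ⊢
      exact ⟨h1.2, hK.mem_of_act h1.2 h1.1⟩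
    | overLeftDown o x y =>
      simp only [List.mem_cons, List.not_mem_nil, or_false, forall_eq_or_imp, forall_eq] at h1 ⊢
      exact ⟨h1.2, hK.act _ h1.1 _ h1.2⟩
  intro a ha
  simp only [List.mem_append] at ha
  rcases ha with (ha | ha) | ha
  · exact hs a (by simp [ha])
  · exact h2 a ha
  · exact hs a (by simp [ha])

theorem Level.ColorsIn.of_piece {K : Set X} (hK : ActClosed K) {i : ℕ} {P : Shape}
    (hP : ∀ o, P ≠ .cup o) {s t : Level X} (h : (Piece.mk i P).Colored s t)
    (hs : Level.ColorsIn K s) : Level.ColorsIn K t := by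
  cases P with
  | cup o => exact (hP o rfl).elim
  | cross b => exact .of_cross hK h hs
  | cap =>
    obtain ⟨L, A, B, R, hL, hP, rfl, rfl⟩ := h
    cases hP
    exact fun a ha => hs a (by simp at ha ⊢; tauto)

theorem Level.ColorsIn.of_piece_above {K : Set X} (hK : ActClosed K) {i : ℕ} {P : Shape}
    (hP : P ≠ .cap) {s t : Level X} (h : (Piece.mk i P).Colored s t)
    (ht : Level.ColorsIn K t) : Level.ColorsIn K s := by
  cases P with
  | cap => exact (hP rfl).elim
  | cross b => exact .of_cross hK h.cross_symm ht
  | cup o =>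
    obtain ⟨L, A, B, R, hL, hP, rfl, rfl⟩ := h
    cases hP
    exact fun a ha => ht a (by simp at ha ⊢; tauto)

/-- A minimum could introduce an arbitrary color, but since `i ≠ j` the maximum does not absorb both
of its legs. The left leg (if `i < j`) or the right leg (if `j < i`) survives to `t`, where its
color is known. -/
theorem Level.ColorsIn.of_cup_cap {K : Set X} {i j : ℕ} {o : Bool} (hij : i ≠ j)
    {s u t : Level X} (h : (Piece.mk i (.cup o)).Colored s u) (h' : (Piece.mk j .cap).Colored u t)
    (hs : Level.ColorsIn K s) (ht : Level.ColorsIn K t) : Level.ColorsIn K u := by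
  obtain ⟨L, A, B, R, hL, hP, rfl, rfl⟩ := h
  obtain ⟨L', A', B', R', hL', hP', he, rfl⟩ := h'
  cases hP with | cup o x =>
  cases hP' with | cap o' y =>
  simp only at hL hL'
  have hx : x ∈ K := by
    rcases lt_or_gt_of_ne hij with h | h
    · have e : (L' ++ [⟨o', y⟩, ⟨!o', y⟩] ++ R')[i]? = some ⟨o, x⟩ := by
        rw [← he, List.append_assoc, List.getElem?_append_right (by omega)]
        simp [hL]
      rw [List.append_assoc, List.getElem?_append_left (by omega)] at e
      exact ht ⟨o, x⟩ (by simp [List.mem_of_getElem? e])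
    · have e : (L' ++ [⟨o', y⟩, ⟨!o', y⟩] ++ R')[i + 1]? = some ⟨!o, x⟩ := by
        rw [← he, List.append_assoc, List.getElem?_append_right (by omega)]
        simp [hL]
      rw [List.getElem?_append_right (by simp; omega)] at e
      exact ht ⟨!o, x⟩ (by simp [List.mem_of_getElem? e])
  intro a ha
  simp only [List.mem_append, List.mem_cons, List.not_mem_nil, or_false] at ha
  rcases ha with (ha | rfl | rfl) | ha
  · exact hs a (by simp [ha])
  · exact hx
  · exact hx
  · exact hs a (by simp [ha])

theorem IsColoring.colorsIn_zero {K : Set X} {s t : Level X} {C : List (Level X)}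
    (h : IsColoring s [] C t) : ∀ u ∈ C, Level.ColorsIn K u := by
  match C, h with
  | [], _ => simp

theorem IsColoring.colorsIn_one {K : Set X} {s t : Level X} {P : Piece} {C : List (Level X)}
    (h : IsColoring s [P] C t) (ht : Level.ColorsIn K t) : ∀ u ∈ C, Level.ColorsIn K u := by
  match C, h with
  | [u], h =>
    obtain ⟨-, rfl⟩ := h
    simpa using ht

theorem IsColoring.colorsIn_two {K : Set X} {s t : Level X} {P Q : Piece} {C : List (Level X)}
    (h : IsColoring s [P, Q] C t) (ht : Level.ColorsIn K t)
    (hPQ : ∀ u, P.Colored s u → Q.Colored u t → Level.ColorsIn K u) :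
    ∀ u ∈ C, Level.ColorsIn K u := by
  match C, h with
  | [u, v], h =>
    obtain ⟨h1, h2, rfl⟩ := h
    simpa using ⟨hPQ u h1 h2, ht⟩

theorem IsColoring.colorsIn_of_cross {K : Set X} (hK : ActClosed K) {s t : Level X}
    {D : Diagram} (hD : ∀ P ∈ D, ∃ b, P.shape = .cross b) {C : List (Level X)}
    (h : IsColoring s D C t) (hs : Level.ColorsIn K s) : ∀ u ∈ C, Level.ColorsIn K u := by
  induction D generalizing s C with
  | nil => exact h.colorsIn_zero
  | cons P D ih =>
    cases C with
    | nil => exact h.elim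
    | cons u C =>
      obtain ⟨b, hb⟩ := hD P (by simp)
      have hu : Level.ColorsIn K u :=
        .of_cross hK (i := P.pos) (b := b) (by rw [← hb]; exact h.1) hs
      simpa using ⟨hu, ih (fun Q hQ => hD Q (by simp [hQ])) h.2 hu⟩

/-- The new piece has at most one interior level. It is controlled from below across a crossing or a
maximum, or from above across a crossing or a minimum; only a minimum followed by a maximum needs
the separate argument of `of_cup_cap`. -/
theorem PlanarIsotopy.colorsIn {K : Set X} (hK : ActClosed K) {R R' : Diagram}
    (hR : PlanarIsotopy R R' ∨ PlanarIsotopy R' R) {s t : Level X} {C : List (Level X)}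
    (h : IsColoring s R' C t) (hs : Level.ColorsIn K s) (ht : Level.ColorsIn K t) :
    ∀ u ∈ C, Level.ColorsIn K u := by
  rcases hR with hR | hR
  · cases hR with
    | exchange i d P Q =>
      refine h.colorsIn_two ht fun u h1 h2 => ?_
      cases Q with
      | cup o =>
        cases P with
        | cap => exact .of_cup_cap (by simp [Shape.ins]; omega) h1 h2 hs ht
        | _ => exact .of_piece_above hK (by simp) h2 ht
      | _ => exact .of_piece hK (by simp) h1 hs
    | zigzagLeft i o => exact h.colorsIn_zero
    | zigzagRight i o => exact h.colorsIn_zero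
    | slideCap i b => exact h.colorsIn_two ht fun u h1 _ => .of_cross hK h1 hs
    | slideCup i o b => exact h.colorsIn_two ht fun u _ h2 => .of_cross hK h2.cross_symm ht
  · cases hR with
    | exchange i d P Q =>
      refine h.colorsIn_two ht fun u h1 h2 => ?_
      cases P with
      | cup o =>
        cases Q with
        | cap => exact .of_cup_cap (by simp [Shape.outs]; omega) h1 h2 hs ht
        | _ => exact .of_piece_above hK (by simp) h2 ht
      | _ => exact .of_piece hK (by simp) h1 hs
    | zigzagLeft i o =>
      exact h.colorsIn_two ht fun u h1 h2 => .of_cup_cap (by omega) h1 h2 hs ht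
    | zigzagRight i o =>
      exact h.colorsIn_two ht fun u h1 h2 => .of_cup_cap (by omega) h1 h2 hs ht
    | slideCap i b => exact h.colorsIn_two ht fun u h1 _ => .of_cross hK h1 hs
    | slideCup i o b => exact h.colorsIn_two ht fun u _ h2 => .of_cross hK h2.cross_symm ht

theorem Reidemeister.colorsIn {K : Set X} (hK : ActClosed K) {R R' : Diagram}
    (hR : Reidemeister R R' ∨ Reidemeister R' R) {s t : Level X} {C : List (Level X)}
    (h : IsColoring s R' C t) (hs : Level.ColorsIn K s) (ht : Level.ColorsIn K t) :
    ∀ u ∈ C, Level.ColorsIn K u := by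
  rcases hR with hR | hR
  · cases hR with
    | oneCap i b => exact h.colorsIn_one ht
    | oneCup i o b => exact h.colorsIn_one ht
    | two i b => exact h.colorsIn_zero
    | three i a b c _ => exact h.colorsIn_of_cross hK (by simp) hs
  · cases hR with
    | oneCap i b => exact h.colorsIn_two ht fun u h1 _ => .of_cross hK h1 hs
    | oneCup i o b => exact h.colorsIn_two ht fun u _ h2 => .of_cross hK h2.cross_symm ht
    | two i b => exact h.colorsIn_of_cross hK (by simp) hs
    | three i a b c _ => exact h.colorsIn_of_cross hK (by simp) hs

/-- All arcs of the colored diagram have a color in `K`. -/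
def ColoredDiagram.ColorsIn (K : Set X) (E : ColoredDiagram X) : Prop :=
  ∀ s ∈ E.coloring.levels, Level.ColorsIn K s

theorem Move.colorsIn {K : Set X} (hK : ActClosed K) {E E' : ColoredDiagram X} (h : Move E E')
    (hE : E.ColorsIn K) : E'.ColorsIn K := by
  obtain ⟨U, R, R', V, CU, CR, CR', CV, s, t, hR, h1, h2, h3, h4, -, e, -, e'⟩ := h
  simp only [ColoredDiagram.ColorsIn, e, e', List.mem_append] at hE ⊢
  have hs : Level.ColorsIn K s := by
    rcases h1.last_mem with rfl | h
    · exact fun a ha => by simp at ha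
    · exact hE s (by simp [h])
  have ht : Level.ColorsIn K t := by
    rcases h2.last_mem with rfl | h
    · exact hs
    · exact hE t (by simp [h])
  have hCR' : ∀ u ∈ CR', Level.ColorsIn K u := by
    rcases hR with hR | hR | hR | hR
    · exact PlanarIsotopy.colorsIn hK (.inl hR) h3 hs ht
    · exact PlanarIsotopy.colorsIn hK (.inr hR) h3 hs ht
    · exact Reidemeister.colorsIn hK (.inl hR) h3 hs ht
    · exact Reidemeister.colorsIn hK (.inr hR) h3 hs ht
  rintro u ((hu | hu) | hu)
  · exact hE u (by simp [hu])
  · exact hCR' u hu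
  · exact hE u (by simp [hu])

theorem ObtainedByMoves.colorsIn {K : Set X} (hK : ActClosed K) {E E' : ColoredDiagram X}
    (h : ObtainedByMoves E E') (hE : E.ColorsIn K) : E'.ColorsIn K := by
  induction h with
  | refl => exact hE
  | tail _ h ih => exact h.colorsIn hK ih

end Invariance

/-! ### Roots of unity and the unit 1 - x -/

section RootsOfUnity

theorem adjoin_singleton_le_of_mul_mem {A : Type*} [CommRing A] {x : A} {M : AddSubgroup A}
    (h : ∀ y ∈ M, x * y ∈ M) {r y : A} (hr : r ∈ Algebra.adjoin ℤ {x}) (hy : y ∈ M) :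
    r * y ∈ M := by
  induction hr using Algebra.adjoin_induction generalizing y with
  | mem z hz =>
    rw [Set.mem_singleton_iff] at hz
    exact hz ▸ h y hy
  | algebraMap n => simpa using M.zsmul_mem hy n
  | add a b _ _ ha hb => rw [add_mul]; exact M.add_mem (ha hy) (hb hy)
  | mul a b _ _ ha hb => rw [mul_assoc]; exact ha (hb hy)

theorem self_mem_adjoin_int {A : Type*} [CommRing A] (x : A) : x ∈ Algebra.adjoin ℤ {x} :=
  Algebra.subset_adjoin rfl

theorem IsPrimitiveRoot.mem_adjoin_int {A : Type*} [CommRing A] [IsDomain A] {x y : A} {N : ℕ}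
    (h : IsPrimitiveRoot x N) (hN : N ≠ 0) (hy : y ^ N = 1) : y ∈ Algebra.adjoin ℤ {x} := by
  have : NeZero N := ⟨hN⟩
  obtain ⟨i, -, rfl⟩ := h.eq_pow_of_pow_eq_one hy
  exact pow_mem (self_mem_adjoin_int x) i

/-- The powers x^(aj), j < b, sum to zero, so b is the sum of the 1 - x^(aj), and each of these is
divisible by 1 - x. -/
theorem one_sub_dvd_of_pow_ne_one {A : Type*} [CommRing A] [IsDomain A] {x : A} {a b : ℕ}
    (h : x ^ (a * b) = 1) (ha : x ^ a ≠ 1) :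
    ∃ u ∈ Algebra.adjoin ℤ {x}, (1 - x) * u = b := by
  have hg : ∑ j ∈ Finset.range b, (x ^ a) ^ j = 0 := by
    have := mul_neg_geom_sum (x ^ a) b
    rw [← pow_mul, h, sub_self] at this
    exact (mul_eq_zero.1 this).resolve_left (sub_ne_zero.2 ha.symm)
  refine ⟨∑ j ∈ Finset.range b, ∑ i ∈ Finset.range (a * j), x ^ i,
    sum_mem fun j _ => sum_mem fun i _ => pow_mem (self_mem_adjoin_int x) i, ?_⟩
  simp only [Finset.mul_sum, ← pow_mul] at hg ⊢
  simp only [← Finset.mul_sum, mul_neg_geom_sum, Finset.sum_sub_distrib, hg]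
  simp

/-- If `a, b > 1` are coprime and `x` is a primitive `ab`-th root of unity, then `1 - x` is a unit
of `ℤ[x]`. -/
theorem IsPrimitiveRoot.exists_one_sub_mul_eq_one {A : Type*} [CommRing A] [IsDomain A] {x : A}
    {a b : ℕ} (h : IsPrimitiveRoot x (a * b)) (ha : 1 < a) (hb : 1 < b) (hab : a.Coprime b) :
    ∃ u ∈ Algebra.adjoin ℤ {x}, (1 - x) * u = 1 := by
  obtain ⟨u, hu, hu'⟩ := one_sub_dvd_of_pow_ne_one h.pow_eq_one
    (h.pow_ne_one_of_pos_of_lt (by omega) (by nlinarith))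
  obtain ⟨v, hv, hv'⟩ := one_sub_dvd_of_pow_ne_one (a := b) (b := a)
    (by rw [mul_comm]; exact h.pow_eq_one) (h.pow_ne_one_of_pos_of_lt (by omega) (by nlinarith))
  -- So 1 - x divides both `a` and `b` in ℤ[x], and by Bézout it divides 1.
  obtain ⟨c, d, hcd⟩ := hab.isCoprime
  refine ⟨c * v + d * u, add_mem (mul_mem (intCast_mem _ c) hv) (mul_mem (intCast_mem _ d) hu), ?_⟩
  have : (c : A) * a + d * b = 1 := by exact_mod_cast congrArg (Int.cast (R := A)) hcd
  linear_combination (c : A) * hv' + (d : A) * hu' + this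

theorem Nat.one_lt_div_gcd {m k : ℕ} (hk : 1 ≤ k) (hkm : k < m) : 1 < m / m.gcd k := by
  by_contra h
  have h1 := Nat.mul_le_mul_right (m.gcd k) (not_lt.1 h)
  rw [Nat.div_mul_cancel (Nat.gcd_dvd_left m k), one_mul] at h1
  exact absurd (Nat.gcd_le_right m hk) (by omega)

theorem isPrimitiveRoot_exp_mul_div {m : ℕ} (k : ℕ) (hm : m ≠ 0) :
    IsPrimitiveRoot (Complex.exp (2 * Real.pi * Complex.I * k / m)) (m / m.gcd k) := by
  have h1 := Complex.isPrimitiveRoot_exp m hm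
  have h2 : Complex.exp (2 * Real.pi * Complex.I * k / m) =
      Complex.exp (2 * Real.pi * Complex.I / m) ^ k := by
    rw [← Complex.exp_nat_mul]
    congr 1
    ring
  rw [h2, IsPrimitiveRoot.iff_orderOf]
  by_cases hk : k = 0
  · subst hk
    simp [Nat.div_self (Nat.pos_of_ne_zero hm)]
  · rw [orderOf_pow' _ hk, ← h1.eq_orderOf]

theorem IsPrimitiveRoot.mul_of_coprime {A : Type*} [CommMonoid A] {x y : A} {a b : ℕ}
    (hx : IsPrimitiveRoot x a) (hy : IsPrimitiveRoot y b) (hab : a.Coprime b) :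
    IsPrimitiveRoot (x * y) (a * b) := by
  rw [IsPrimitiveRoot.iff_orderOf, (Commute.all x y).orderOf_mul_eq_mul_orderOf_of_coprime,
    ← hx.eq_orderOf, ← hy.eq_orderOf]
  rwa [← hx.eq_orderOf, ← hy.eq_orderOf]

end RootsOfUnity

/-! ### The ring ℤ[ρ] and the lattice of the trochoid -/

namespace Trochoid

/-- The unit complex number of the rotation angle `θ`. -/
noncomputable def rot (T : Trochoid) : ℂ := Circle.exp T.theta

/-- The ring generated by the rotation by the angle `θ`. -/
noncomputable def rotRing (T : Trochoid) : Subalgebra ℤ ℂ := Algebra.adjoin ℤ {T.rot}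

/-- The quotient of two successive edges of `P₀`. -/
noncomputable def turnW (T : Trochoid) : ℂ := Complex.exp (2 * Real.pi * Complex.I * T.k / T.m)

/-- The quotient of two successive edges of `Q`. -/
noncomputable def turnV (T : Trochoid) : ℂ := Complex.exp (2 * Real.pi * Complex.I * T.l / T.n)

theorem turnW_ne_zero (T : Trochoid) : T.turnW ≠ 0 := Complex.exp_ne_zero _

theorem turnV_ne_zero (T : Trochoid) : T.turnV ≠ 0 := Complex.exp_ne_zero _

theorem rot_ne_zero (T : Trochoid) : T.rot ≠ 0 := Circle.coe_ne_zero _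

theorem rot_mul_turnW (T : Trochoid) : T.rot * T.turnW = T.turnV := T.exp_theta

/-- The number of sides of the underlying polygon of `P₀`. -/
def orderW (T : Trochoid) : ℕ := T.m / T.m.gcd T.k

/-- The number of sides of the underlying polygon of `Q`. -/
def orderV (T : Trochoid) : ℕ := T.n / T.n.gcd T.l

theorem one_lt_orderW (T : Trochoid) : 1 < T.orderW :=
  Nat.one_lt_div_gcd T.hk.1 (by have := T.hm; have := T.hk; omega)

theorem one_lt_orderV (T : Trochoid) : 1 < T.orderV :=
  Nat.one_lt_div_gcd T.hl.1 (by have := T.hn; have := T.hl; omega)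

theorem order_ne_zero (T : Trochoid) : T.orderW * T.orderV ≠ 0 := by
  have := T.one_lt_orderW
  have := T.one_lt_orderV
  positivity

theorem isPrimitiveRoot_turnW (T : Trochoid) : IsPrimitiveRoot T.turnW T.orderW :=
  isPrimitiveRoot_exp_mul_div _ (by have := T.hm; omega)

theorem isPrimitiveRoot_turnV (T : Trochoid) : IsPrimitiveRoot T.turnV T.orderV :=
  isPrimitiveRoot_exp_mul_div _ (by have := T.hn; omega)

theorem coprime_order (T : Trochoid) (h : T.m.Coprime T.n) : T.orderW.Coprime T.orderV :=
  Nat.Coprime.of_dvd (Nat.div_dvd_of_dvd (Nat.gcd_dvd_left _ _))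
    (Nat.div_dvd_of_dvd (Nat.gcd_dvd_left _ _)) h

theorem isPrimitiveRoot_rot (T : Trochoid) (h : T.m.Coprime T.n) :
    IsPrimitiveRoot T.rot (T.orderW * T.orderV) := by
  have h1 := T.isPrimitiveRoot_turnW.inv.mul_of_coprime T.isPrimitiveRoot_turnV (T.coprime_order h)
  rwa [← T.rot_mul_turnW, mul_comm, mul_assoc, mul_inv_cancel₀ T.turnW_ne_zero, mul_one] at h1

theorem turnW_zpow_mem (T : Trochoid) (h : T.m.Coprime T.n) (i : ℤ) :
    T.turnW ^ i ∈ T.rotRing := by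
  refine (T.isPrimitiveRoot_rot h).mem_adjoin_int T.order_ne_zero ?_
  rw [← zpow_natCast, zpow_comm, zpow_natCast, pow_mul, T.isPrimitiveRoot_turnW.pow_eq_one]
  simp

theorem turnV_zpow_mem (T : Trochoid) (h : T.m.Coprime T.n) (i : ℤ) :
    T.turnV ^ i ∈ T.rotRing := by
  refine (T.isPrimitiveRoot_rot h).mem_adjoin_int T.order_ne_zero ?_
  rw [← zpow_natCast, zpow_comm, zpow_natCast, mul_comm, pow_mul,
    T.isPrimitiveRoot_turnV.pow_eq_one]
  simp

theorem rot_mem (T : Trochoid) : T.rot ∈ T.rotRing := self_mem_adjoin_int _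

theorem rot_inv_mem (T : Trochoid) (h : T.m.Coprime T.n) : T.rot⁻¹ ∈ T.rotRing :=
  (T.isPrimitiveRoot_rot h).mem_adjoin_int T.order_ne_zero
    (by rw [inv_pow, (T.isPrimitiveRoot_rot h).pow_eq_one, inv_one])

theorem w_succ (T : Trochoid) (i : ℤ) : T.w (i + 1) = T.w i + (T.w 1 - T.w 0) * T.turnW ^ i := by
  obtain ⟨c, r, -, h⟩ := T.regular_w
  simp only [h, exp_step, zpow_add₀ (Complex.exp_ne_zero _), turnW]
  simp only [zpow_zero, zpow_one]
  ring

theorem v_succ (T : Trochoid) (i : ℤ) : T.v (i + 1) = T.v i + (T.w 1 - T.w 0) * T.turnV ^ i := by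
  obtain ⟨c, r, -, h⟩ := T.regular_v
  rw [T.start_zero, T.start_one]
  simp only [h, exp_step, zpow_add₀ (Complex.exp_ne_zero _), turnV]
  simp only [zpow_zero, zpow_one]
  ring

/-- The translate by the first vertex of the multiples of the first edge by the elements of the
ring generated by the rotation by the angle `θ`. -/
def lattice (T : Trochoid) : Set ℂ := {x | ∃ r ∈ T.rotRing, x = T.w 0 + (T.w 1 - T.w 0) * r}

theorem lattice_rotate (T : Trochoid) {x y r : ℂ} (hx : x ∈ T.lattice) (hy : y ∈ T.lattice)
    (hr : r ∈ T.rotRing) : (x - y) * r + y ∈ T.lattice := by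
  obtain ⟨a, ha, rfl⟩ := hx
  obtain ⟨b, hb, rfl⟩ := hy
  exact ⟨(a - b) * r + b, add_mem (mul_mem (sub_mem ha hb) hr) hb, by ring⟩

/-- The vertices of both polygons are sums of edges, each of which is the common first edge times a
root of unity in ℤ[ρ]. -/
theorem mem_lattice_of_succ (T : Trochoid) {f g : ℤ → ℂ} (hg : ∀ i, g i ∈ T.rotRing)
    (h0 : f 0 = T.w 0) (h : ∀ i, f (i + 1) = f i + (T.w 1 - T.w 0) * g i) (i : ℤ) :
    f i ∈ T.lattice := by
  induction i with
  | zero => exact ⟨0, zero_mem _, by simp [h0]⟩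
  | succ i ih =>
    obtain ⟨a, ha, e⟩ := ih
    exact ⟨a + g i, add_mem ha (hg _), by rw [h, e]; ring⟩
  | pred i ih =>
    obtain ⟨a, ha, e⟩ := ih
    refine ⟨a - g (-i - 1), sub_mem ha (hg _), ?_⟩
    have := h (-i - 1)
    rw [sub_add_cancel, e] at this
    linear_combination -this

theorem w_mem_lattice (T : Trochoid) (h : T.m.Coprime T.n) (i : ℤ) : T.w i ∈ T.lattice :=
  T.mem_lattice_of_succ (T.turnW_zpow_mem h) rfl T.w_succ i

theorem v_mem_lattice (T : Trochoid) (h : T.m.Coprime T.n) (i : ℤ) : T.v i ∈ T.lattice :=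
  T.mem_lattice_of_succ (T.turnV_zpow_mem h) T.start_zero.symm T.v_succ i

theorem vertex_mem_lattice (T : Trochoid) (h : T.m.Coprime T.n) (i : ℕ) (j : ℤ) :
    T.vertex i j ∈ T.lattice := by
  induction i with
  | zero => exact T.w_mem_lattice h j
  | succ i ih => exact T.lattice_rotate ih (T.v_mem_lattice h _) T.rot_mem

theorem alpha_eq (T : Trochoid) : T.alpha =
    if Even (T.orderW * T.orderV) then T.orderW * T.orderV / 2 else T.orderW * T.orderV := rfl

theorem alpha_ne_zero (T : Trochoid) : T.alpha ≠ 0 := by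
  have h1 := T.one_lt_orderW
  have h2 := T.one_lt_orderV
  have h3 : 2 ≤ T.orderW * T.orderV := by nlinarith
  rw [alpha_eq]
  split_ifs <;> omega

theorem isPrimitiveRoot_exp_alpha (T : Trochoid) :
    IsPrimitiveRoot (Complex.exp (Real.pi * Complex.I / T.alpha)) (2 * T.alpha) := by
  have h := T.alpha_ne_zero
  have := Complex.isPrimitiveRoot_exp (2 * T.alpha) (by omega)
  convert this using 2
  push_cast
  field_simp

theorem exp_alpha_mem (T : Trochoid) (h : T.m.Coprime T.n) :
    Complex.exp (Real.pi * Complex.I / T.alpha) ∈ T.rotRing := by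
  have h1 := T.isPrimitiveRoot_exp_alpha
  have h2 := T.isPrimitiveRoot_rot h
  have h3 := T.alpha_eq
  split_ifs at h3 with h4
  · exact h2.mem_adjoin_int T.order_ne_zero
      (by rw [← Nat.two_mul_div_two_of_even h4, ← h3, h1.pow_eq_one])
  -- Here p'q' = α is odd and ζ^α = -1, so that -ζ, rather than ζ, is a p'q'-th root of unity.
  · have h5 : Complex.exp (Real.pi * Complex.I / T.alpha) ^ T.alpha = -1 := by
      rw [← Complex.exp_nat_mul, mul_div_cancel₀ _ (by exact_mod_cast T.alpha_ne_zero),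
        Complex.exp_pi_mul_I]
    rw [Nat.not_even_iff_odd, ← h3] at h4
    rw [← neg_neg (Complex.exp _)]
    exact neg_mem (h2.mem_adjoin_int T.order_ne_zero
      (by rw [← h3, h4.neg_pow, h5, neg_neg]))

theorem rot_eq_pow (T : Trochoid) (h : T.m.Coprime T.n) :
    ∃ j : ℕ, T.rot = Complex.exp (Real.pi * Complex.I / T.alpha) ^ j := by
  have h1 := T.isPrimitiveRoot_exp_alpha
  have h2 := T.isPrimitiveRoot_rot h
  have h3 := T.alpha_eq
  have : NeZero (2 * T.alpha) := ⟨by have := T.alpha_ne_zero; omega⟩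
  obtain ⟨j, -, hj⟩ := h1.eq_pow_of_pow_eq_one (ξ := T.rot) (by
    split_ifs at h3 with h4
    · rw [h3, Nat.two_mul_div_two_of_even h4, h2.pow_eq_one]
    · rw [h3, mul_comm, pow_mul, h2.pow_eq_one, one_pow])
  exact ⟨j, hj.symm⟩

theorem direction_eq (T : Trochoid) (h : ‖T.w 1 - T.w 0‖ = 1) (σ : ℕ) : T.direction σ =
    (T.w 1 - T.w 0) * Complex.exp (Real.pi * Complex.I / T.alpha) ^ σ := by
  have h1 := Complex.norm_mul_exp_arg_mul_I (T.w 1 - T.w 0)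
  rw [h, Complex.ofReal_one, one_mul] at h1
  conv_rhs => rw [← h1]
  rw [direction, ← Complex.exp_nat_mul, ← Complex.exp_add, Complex.ofReal_cos, Complex.ofReal_sin,
    mul_comm Complex.I, ← Complex.exp_mul_I]
  congr 1
  simp only [vertex]
  push_cast
  ring

/-- The elements of the ring generated by a power of a root of unity `x` are integer linear
combinations of the powers of `x`. -/
theorem exists_sum_pow_of_mem_adjoin {x y : ℂ} {N j : ℕ} (hN : N ≠ 0) (hx : x ^ N = 1)
    (hy : y = x ^ j) {r : ℂ} (hr : r ∈ Algebra.adjoin ℤ {y}) :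
    ∃ a : ℕ → ℤ, r = ∑ σ ∈ Finset.range N, (a σ : ℂ) * x ^ σ := by
  let M : AddSubgroup ℂ :=
    { carrier := {r | ∃ a : ℕ → ℤ, r = ∑ σ ∈ Finset.range N, (a σ : ℂ) * x ^ σ}
      zero_mem' := ⟨0, by simp⟩
      add_mem' := by
        rintro _ _ ⟨a, rfl⟩ ⟨b, rfl⟩
        exact ⟨a + b, by simp [Finset.sum_add_distrib, add_mul]⟩
      neg_mem' := by
        rintro _ ⟨a, rfl⟩
        exact ⟨-a, by simp⟩ }
  have hpow : ∀ i, x ^ i ∈ M := fun i => by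
    refine ⟨fun σ => if σ = i % N then 1 else 0, ?_⟩
    have : i % N < N := Nat.mod_lt _ (Nat.pos_of_ne_zero hN)
    simp only [Int.cast_ite, Int.cast_one, Int.cast_zero, ite_mul, one_mul, zero_mul,
      Finset.sum_ite_eq', Finset.mem_range, this, if_true]
    conv_lhs => rw [← Nat.div_add_mod i N, pow_add, pow_mul, hx, one_pow, one_mul]
  have hmul : ∀ r ∈ M, y * r ∈ M := by
    rintro _ ⟨a, rfl⟩
    rw [Finset.mul_sum]
    refine sum_mem fun σ _ => ?_
    have e : y * ((a σ : ℂ) * x ^ σ) = a σ • x ^ (j + σ) := by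
      rw [hy, pow_add, zsmul_eq_mul]; ring
    exact e ▸ M.zsmul_mem (hpow _) _
  have := adjoin_singleton_le_of_mul_mem hmul hr (hpow 0)
  rwa [pow_zero, mul_one] at this

/-- Both ρ and ζ = exp(iπ/α) lie in the ring generated by the other, and exponents of ζ matter only
modulo 2α. -/
theorem lattice_eq (T : Trochoid) (h : T.m.Coprime T.n) (he : ‖T.w 1 - T.w 0‖ = 1) :
    T.lattice = {z : ℂ | ∃ a : ℕ → ℤ, z = T.vertex 0 0 +
        ∑ σ ∈ Finset.range (2 * T.alpha), (a σ : ℂ) * T.direction σ} := by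
  have hsum : ∀ a : ℕ → ℤ, ∑ σ ∈ Finset.range (2 * T.alpha), (a σ : ℂ) * T.direction σ =
      (T.w 1 - T.w 0) * ∑ σ ∈ Finset.range (2 * T.alpha),
        (a σ : ℂ) * Complex.exp (Real.pi * Complex.I / T.alpha) ^ σ := fun a => by
    rw [Finset.mul_sum]
    exact Finset.sum_congr rfl fun σ _ => by rw [T.direction_eq he]; ring
  ext z
  constructor
  · rintro ⟨r, hr, rfl⟩
    obtain ⟨j, hj⟩ := T.rot_eq_pow h
    obtain ⟨a, rfl⟩ := exists_sum_pow_of_mem_adjoin (by have := T.alpha_ne_zero; omega)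
      T.isPrimitiveRoot_exp_alpha.pow_eq_one hj hr
    exact ⟨a, by rw [hsum]; rfl⟩
  · rintro ⟨a, rfl⟩
    exact ⟨_, sum_mem fun σ _ => mul_mem (intCast_mem _ _) (pow_mem (T.exp_alpha_mem h) σ),
      by rw [hsum]; rfl⟩

end Trochoid

/-! ### Colors of the standard diagram and the upper bound for moves -/

namespace Trochoid

theorem w_period (T : Trochoid) : T.w T.m = T.w 0 := by simpa using T.w_periodic 0

theorem color_mem_levels (T : Trochoid) (o : Bool) {s : Level RotE2} (hs : s ∈ T.levels o)
    {a : Strand RotE2} (ha : a ∈ s) : ∃ i j, a.color = T.color i j := by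
  have hrow : ∀ i r, ∀ x ∈ T.row i r, ∃ i j, x = T.color i j := by
    intro i r x hx
    simp only [row, List.mem_append, List.mem_map, List.mem_cons] at hx
    rcases hx with ⟨j, -, rfl⟩ | rfl | ⟨j, -, rfl⟩ <;> exact ⟨_, _, rfl⟩
  have hbraid : ∀ i r, ∀ a ∈ T.braidLevel o i r, ∃ i j, a.color = T.color i j := by
    intro i r a ha
    simp only [braidLevel, List.mem_map] at ha
    obtain ⟨x, hx, rfl⟩ := ha
    refine hrow i r x ?_
    split_ifs at hx <;> simpa using hx
  have hclosing : ∀ s : Level RotE2, (∀ a ∈ s, ∃ i j, a.color = T.color i j) →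
      ∀ a ∈ closing s, ∃ i j, a.color = T.color i j := by
    intro s hs a ha
    simp only [closing, List.mem_map, List.mem_reverse] at ha
    obtain ⟨b, hb, rfl⟩ := ha
    exact hs b hb
  have hnested : ∀ r, ∀ a ∈ T.nestedLevel o r, ∃ i j, a.color = T.color i j := by
    intro r a ha
    have h : ∀ a ∈ (T.braidLevel o 0 0).take r, ∃ i j, a.color = T.color i j :=
      fun a ha => hbraid 0 0 a (List.mem_of_mem_take ha)
    rcases List.mem_append.1 ha with ha | ha
    · exact h a ha
    · exact hclosing _ h a ha
  simp only [levels, List.mem_append, List.mem_map, List.mem_flatMap] at hs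
  rcases hs with (⟨r, -, rfl⟩ | ⟨i, -, r, -, rfl⟩) | ⟨r, -, rfl⟩
  · exact hnested _ a ha
  · rcases List.mem_append.1 ha with ha | ha
    · exact hbraid _ _ a ha
    · exact hclosing _ (hbraid 0 0) a ha
  · exact hnested _ a ha

/-- The level through the top of the minima. -/
theorem closed_level_mem_levels (T : Trochoid) (o : Bool) :
    T.braidLevel o 0 0 ++ closing (T.braidLevel o 0 0) ∈ T.levels o := by
  have hm := T.hm
  have hl : (T.braidLevel o 0 0).length = T.m := by
    have := T.row_length 0 0 (by omega)
    cases o <;> simp [braidLevel, this]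
  simp only [levels, List.mem_append, List.mem_map, List.mem_range]
  refine .inl (.inl ⟨T.m - 1, by omega, ?_⟩)
  rw [nestedLevel, List.take_of_length_le (by omega)]

theorem color_mem_braidLevel (T : Trochoid) (o : Bool) {j : ℕ} (hj : j < T.m) :
    Strand.mk o (T.color 0 j) ∈ T.braidLevel o 0 0 := by
  have h : T.color 0 j ∈ T.row 0 0 := by
    rcases j with _ | j
    · simp [row]
    · simp only [row, List.mem_append, List.mem_cons, List.mem_map, List.mem_range'_1]
      exact .inr (.inr ⟨j + 1, by omega, rfl⟩)
  refine List.mem_map.2 ⟨_, ?_, rfl⟩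
  split_ifs <;> simpa using h

theorem uses_of_color (T : Trochoid) (p q : ℤ) (hp : T.m = p.natAbs) (hq : T.n = q.natAbs) {j : ℕ}
    (hj : j < T.m) : (T.coloring p q hp hq).Uses (T.color 0 j) :=
  ⟨_, T.closed_level_mem_levels _, _,
    List.mem_append_left _ (T.color_mem_braidLevel _ hj), rfl⟩

theorem center_color_zero (T : Trochoid) (j : ℕ) : (T.color 0 j).center = T.w (j + 1) := by
  simp [color, vertex]

/-- The second index wraps around here. Thus both ends of the first edge are centers in the bottom
row: `w 1` on the arc with `j = 0`, `w 0` on the last arc. -/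
theorem center_color_last (T : Trochoid) : (T.color 0 (T.m - 1)).center = T.w 0 := by
  have hm := T.hm
  rw [center_color_zero, ← T.w_period]
  congr 1
  omega

theorem actClosed_lattice (T : Trochoid) (h : T.m.Coprime T.n) :
    ActClosed {x : RotE2 | x.center ∈ T.lattice ∧ x.angle = Circle.exp T.theta} where
  act x hx y hy := ⟨T.lattice_rotate hx.1 hy.1 (by rw [hy.2]; exact T.rot_mem), hx.2⟩
  invAct x hx y hy := ⟨T.lattice_rotate hx.1 hy.1 (by
    rw [hy.2, Circle.coe_inv]; exact T.rot_inv_mem h), hx.2⟩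

theorem pointsByMoves_subset (T : Trochoid) (p q : ℤ) (hp : T.m = p.natAbs) (hq : T.n = q.natAbs)
    (h : T.m.Coprime T.n) : (T.coloring p q hp hq).pointsByMoves ⊆ T.lattice := by
  rintro z ⟨E, hE, x, ⟨s, hs, a, ha, rfl⟩, rfl⟩
  refine (hE.colorsIn (T.actClosed_lattice h) ?_ s hs a ha).1
  intro s hs a ha
  obtain ⟨i, j, e⟩ := T.color_mem_levels _ hs ha
  rw [e]
  exact ⟨T.vertex_mem_lattice h _ _, rfl⟩

end Trochoid

/-! ### Translations from rotations and the lower bound for moves -/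

theorem IsColoring.split {X : Type*} [Quandle X] {s t u : Level X} {D : Diagram}
    {C : List (Level X)} (h : IsColoring s D C t) (hu : u ∈ C) : ∃ D₁ D₂ C₁ C₂,
      IsColoring s D₁ C₁ u ∧ IsColoring u D₂ C₂ t ∧ D = D₁ ++ D₂ ∧ C = C₁ ++ C₂ := by
  induction D generalizing s C with
  | nil =>
    cases C with
    | nil => simp at hu
    | cons _ _ => exact h.elim
  | cons P D ih =>
    cases C with
    | nil => exact h.elim
    | cons a C =>
      rcases List.mem_cons.1 hu with rfl | hu
      · exact ⟨[P], D, [u], C, ⟨h.1, rfl⟩, h.2, rfl, rfl⟩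
      · obtain ⟨D₁, D₂, C₁, C₂, h1, h2, rfl, rfl⟩ := ih h.2 hu
        exact ⟨P :: D₁, D₂, a :: C₁, C₂, ⟨h.1, h1⟩, h2, rfl, rfl⟩

theorem ColoredDiagram.meets_of_mem {X : Type*} [Quandle X] (E : ColoredDiagram X) {s : Level X}
    (hs : s ∈ E.coloring.levels) : E.Meets s := by
  obtain ⟨U, V, CU, CV, h⟩ := E.coloring.valid.split hs
  exact ⟨U, V, CU, CV, h⟩

namespace RotE2

/-- The translation of the centers of rotation. -/
def translate (τ : ℂ) : Equiv.Perm RotE2 where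
  toFun x := ⟨x.center + τ, x.angle⟩
  invFun x := ⟨x.center - τ, x.angle⟩
  left_inv x := by simp
  right_inv x := by simp

theorem act'_mul_inv (x y : RotE2) (h : x.angle = y.angle) :
    Rack.act' x * (Rack.act' y)⁻¹ = translate ((x.center - y.center) * (1 - (y.angle : ℂ))) := by
  ext a
  · have h0 := Circle.coe_ne_zero y.angle
    change ((a.center - y.center) * ((y.angle⁻¹ : Circle) : ℂ) + y.center - x.center) *
      (x.angle : ℂ) + x.center = a.center + _
    rw [h, Circle.coe_inv]
    field_simp
    ring
  · rfl

theorem act'_conj_translate (x : RotE2) (τ : ℂ) :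
    Rack.act' x * translate τ * (Rack.act' x)⁻¹ = translate ((x.angle : ℂ) * τ) := by
  ext a
  · have h0 := Circle.coe_ne_zero x.angle
    change ((a.center - x.center) * ((x.angle⁻¹ : Circle) : ℂ) + x.center + τ - x.center) *
      (x.angle : ℂ) + x.center = a.center + _
    rw [Circle.coe_inv]
    field_simp
    ring
  · rfl

/-- The translations in a group of permutations of the rotations. -/
def translations (G : Subgroup (Equiv.Perm RotE2)) : AddSubgroup ℂ where
  carrier := {τ | translate τ ∈ G}
  zero_mem' := by
    have : translate 0 = 1 := by ext x <;> simp [translate]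
    simp [this, G.one_mem]
  add_mem' {a b} ha hb := by
    have : translate (a + b) = translate a * translate b := by
      ext x
      · simp [translate]; ring
      · rfl
    simpa [this] using G.mul_mem ha hb
  neg_mem' {a} ha := by
    have : translate (-a) = (translate a)⁻¹ := by
      rw [eq_inv_iff_mul_eq_one]
      ext x <;> simp [translate]
    simpa [this] using ha

end RotE2

namespace Trochoid

theorem translate_mem_monodromy (T : Trochoid) (h : T.m.Coprime T.n) (o : Bool) {r : ℂ}
    (hr : r ∈ T.rotRing) : RotE2.translate ((T.w 1 - T.w 0) * r) ∈
      Level.monodromy (T.braidLevel o 0 0 ++ closing (T.braidLevel o 0 0)) := by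
  set G := Level.monodromy (T.braidLevel o 0 0 ++ closing (T.braidLevel o 0 0))
  have hm := T.hm
  have hG : ∀ j < T.m, Rack.act' (T.color 0 j) ∈ G := fun j hj =>
    (Level.closed_append_closing _).act_mem_monodromy
      (List.mem_append_left _ (T.color_mem_braidLevel o hj))
  -- Conjugating a translation by a rotation by θ multiplies it by ρ, so the translations in `G`
  -- form a ℤ[ρ]-module.
  have h1 : ∀ τ ∈ RotE2.translations G, T.rot * τ ∈ RotE2.translations G := fun τ hτ => by
    have := G.mul_mem (G.mul_mem (hG 0 (by omega)) hτ) (G.inv_mem (hG 0 (by omega)))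
    rwa [RotE2.act'_conj_translate] at this
  -- This is the rotation about `w 1` composed with the inverse of the rotation about `w 0`.
  have h2 : (T.w 1 - T.w 0) * (1 - T.rot) ∈ RotE2.translations G := by
    have := G.mul_mem (hG 0 (by omega)) (G.inv_mem (hG (T.m - 1) (by omega)))
    rw [RotE2.act'_mul_inv _ _ (by rfl), center_color_last, center_color_zero,
      Nat.cast_zero, zero_add] at this
    exact this
  obtain ⟨u, hu, hu1⟩ := (T.isPrimitiveRoot_rot h).exists_one_sub_mul_eq_one T.one_lt_orderW
    T.one_lt_orderV (T.coprime_order h)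
  -- The factor `u`, inverse to 1 - ρ, removes the factor 1 - ρ of `h2`.
  have h3 := adjoin_singleton_le_of_mul_mem h1 (mul_mem hr hu) h2
  have e : (T.w 1 - T.w 0) * r = r * u * ((T.w 1 - T.w 0) * (1 - T.rot)) := by
    linear_combination -(T.w 1 - T.w 0) * r * hu1
  rw [e]
  exact h3

theorem subset_pointsByMoves (T : Trochoid) (p q : ℤ) (hp : T.m = p.natAbs) (hq : T.n = q.natAbs)
    (h : T.m.Coprime T.n) : T.lattice ⊆ (T.coloring p q hp hq).pointsByMoves := by
  rintro _ ⟨r, hr, rfl⟩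
  have hm := T.hm
  have h1 : (ColoredDiagram.mk _ (T.coloring p q hp hq)).Meets _ :=
    ColoredDiagram.meets_of_mem _ (T.closed_level_mem_levels (decide (0 < p * q)))
  obtain ⟨E, hE, hE'⟩ := h1.braided (T.translate_mem_monodromy h (decide (0 < p * q)) hr).2
  have h2 := List.mem_map_of_mem
    (f := Strand.recolor (RotE2.translate ((T.w 1 - T.w 0) * r)))
    (List.mem_append_left (closing (T.braidLevel (decide (0 < p * q)) 0 0))
      (T.color_mem_braidLevel (decide (0 < p * q)) (show T.m - 1 < T.m by omega)))
  exact ⟨E, hE, _, hE'.uses h2, congrArg (· + (T.w 1 - T.w 0) * r) T.center_color_last⟩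

/-! ### Shifts and switches -/

theorem shift_w_zero (T : Trochoid) : T.shift.w 0 = T.w 1 := by
  rw [T.start_one]
  exact T.vertex_self 1

theorem shift_w_one (T : Trochoid) : T.shift.w 1 = T.w 1 + (T.w 1 - T.w 0) * T.turnV := by
  have h := T.v_succ 1
  rw [zpow_one, ← T.start_one] at h
  rw [← h]
  exact T.vertex_succ 1

theorem switch_theta (T : Trochoid) : T.switch.theta = T.theta := by
  have hm : (T.m : ℝ) ≠ 0 := by have := T.hm; exact_mod_cast (by omega : T.m ≠ 0)
  have hn : (T.n : ℝ) ≠ 0 := by have := T.hn; exact_mod_cast (by omega : T.n ≠ 0)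
  have hk : T.k ≤ T.m := by have := T.hk; omega
  have hl : T.l ≤ T.n := by have := T.hl; omega
  simp only [theta, switch]
  push_cast [Nat.cast_sub hk, Nat.cast_sub hl]
  field_simp
  ring

theorem switch_w_zero (T : Trochoid) : T.switch.w 0 = T.w 1 := by
  rw [T.start_one]
  simp [switch]

theorem switch_w_one (T : Trochoid) : T.switch.w 1 = T.w 0 := by
  rw [T.start_zero]
  simp [switch]

/-- Between the two switches the fixed polygon is P₀ traversed backwards, so the shift moves the
common edge one step back along P₀. -/
theorem switch_shift_switch_w (T : Trochoid) (j : ℤ) :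
    T.switch.shift.switch.w j = T.w (j - 1) := by
  change T.w (1 - (1 - j + 1)) = _
  congr 1
  ring

theorem lattice_shift_subset (T : Trochoid) (h : T.m.Coprime T.n) :
    T.shift.lattice ⊆ T.lattice := by
  rintro _ ⟨r, hr, rfl⟩
  refine ⟨1 + T.turnV ^ (1 : ℤ) * r, add_mem (one_mem _) (mul_mem (T.turnV_zpow_mem h 1) hr), ?_⟩
  rw [shift_w_zero, shift_w_one, zpow_one]
  ring

theorem lattice_switch_subset (T : Trochoid) : T.switch.lattice ⊆ T.lattice := by
  rintro _ ⟨r, hr, rfl⟩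
  rw [rotRing, rot, switch_theta] at hr
  refine ⟨1 - r, sub_mem (one_mem _) hr, ?_⟩
  rw [switch_w_zero, switch_w_one]
  ring

theorem Deforms.lattice_subset {T T' : Trochoid} {s : ℕ} (h : T.Deforms s T')
    (hT : T.m.Coprime T.n) : T'.m.Coprime T'.n ∧ T'.lattice ⊆ T.lattice := by
  induction h with
  | refl => exact ⟨hT, subset_rfl⟩
  | shift _ ih => exact ⟨ih.1, (lattice_shift_subset _ ih.1).trans ih.2⟩
  | switch _ ih => exact ⟨ih.1.symm, (lattice_switch_subset _).trans ih.2⟩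

theorem pointsByDeformations_subset (T : Trochoid) (p q : ℤ) (h : T.m.Coprime T.n) :
    T.pointsByDeformations p q ⊆ T.lattice := by
  rintro z ⟨s, T', hp, hq, -, hT, x, ⟨t, ht, a, ha, rfl⟩, rfl⟩
  obtain ⟨h1, h2⟩ := hT.lattice_subset h
  obtain ⟨i, j, e⟩ := T'.color_mem_levels _ ht ha
  rw [e]
  exact h2 (T'.vertex_mem_lattice h1 _ _)

/-- Shifts and an even number of switches move the common first edge to the edge from `x` to
`x + d`. -/
def Reaches (T : Trochoid) (x d : ℂ) : Prop :=
  ∃ (s : ℕ) (T' : Trochoid), Even s ∧ T.Deforms s T' ∧ T'.m = T.m ∧ T'.k = T.k ∧ T'.n = T.n ∧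
    T'.l = T.l ∧ T'.w 0 = x ∧ T'.w 1 = x + d

theorem Reaches.next {T : Trochoid} {x d : ℂ} (h : T.Reaches x d) :
    T.Reaches (x + d) (d * T.turnV) := by
  obtain ⟨s, T', hs, hT, hm, hk, hn, hl, h0, h1⟩ := h
  have e : T'.turnV = T.turnV := by rw [turnV, turnV, hn, hl]
  refine ⟨s, T'.shift, hs, hT.shift, hm, hk, hn, hl, by rw [shift_w_zero, h1], ?_⟩
  rw [shift_w_one, h1, h0, e]
  ring

theorem Reaches.prev {T : Trochoid} {x d : ℂ} (h : T.Reaches x d) :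
    T.Reaches (x - d * T.turnW⁻¹) (d * T.turnW⁻¹) := by
  obtain ⟨s, T', hs, hT, hm, hk, hn, hl, h0, h1⟩ := h
  have e : T'.turnW = T.turnW := by rw [turnW, turnW, hm, hk]
  have h2 := T'.w_succ (-1)
  rw [neg_add_cancel, h0, h1, e, zpow_neg_one] at h2
  have hk' := T'.hk
  have hl' := T'.hl
  refine ⟨s + 1 + 1, T'.switch.shift.switch, by simpa [add_assoc, parity_simps] using hs,
    hT.switch.shift.switch, hm, ?_, hn, ?_, ?_, ?_⟩
  · change T'.m - (T'.m - T'.k) = T.k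
    omega
  · change T'.n - (T'.n - T'.l) = T.l
    omega
  · rw [switch_shift_switch_w, zero_sub]
    linear_combination -h2
  · rw [switch_shift_switch_w, sub_self, h0]
    ring

/-- A step back along P₀ followed by a step along Q returns to `x`; the edge is divided by `turnW`
and multiplied by `turnV`. -/
theorem Reaches.rotate {T : Trochoid} {x d : ℂ} (h : T.Reaches x d) : T.Reaches x (T.rot * d) := by
  have h1 := h.prev.next
  rw [sub_add_cancel, ← T.rot_mul_turnW] at h1
  convert h1 using 1
  have := T.turnW_ne_zero
  field_simp

/-- Every p'q'-th root of unity is a nonnegative power of ρ, so rotations in the opposite direction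
are also available. -/
theorem Reaches.rotate_of_pow_eq_one {T : Trochoid} (hT : T.m.Coprime T.n) {x d y : ℂ}
    (h : T.Reaches x d) (hy : y ^ (T.orderW * T.orderV) = 1) : T.Reaches x (y * d) := by
  have : NeZero (T.orderW * T.orderV) := ⟨T.order_ne_zero⟩
  obtain ⟨i, -, rfl⟩ := (T.isPrimitiveRoot_rot hT).eq_pow_of_pow_eq_one hy
  clear hy
  induction i with
  | zero => simpa using h
  | succ i ih =>
    rw [pow_succ', mul_assoc]
    exact ih.rotate

theorem Reaches.add {T : Trochoid} (hT : T.m.Coprime T.n) {x d : ℂ} (h : T.Reaches x d) :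
    T.Reaches (x + d) d := by
  have h1 := h.next.rotate_of_pow_eq_one hT (y := T.turnV⁻¹) (by
    rw [inv_pow, mul_comm, pow_mul, T.isPrimitiveRoot_turnV.pow_eq_one, one_pow, inv_one])
  rwa [mul_left_comm, inv_mul_cancel₀ T.turnV_ne_zero, mul_one] at h1

theorem Reaches.sub {T : Trochoid} (hT : T.m.Coprime T.n) {x d : ℂ} (h : T.Reaches x d) :
    T.Reaches (x - d) d := by
  have h1 := (h.rotate_of_pow_eq_one hT (y := T.turnW) (by
    rw [pow_mul, T.isPrimitiveRoot_turnW.pow_eq_one, one_pow])).prev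
  rwa [mul_right_comm, mul_inv_cancel₀ T.turnW_ne_zero, one_mul] at h1

theorem Reaches.add_mul {T : Trochoid} (hT : T.m.Coprime T.n) {r : ℂ} (hr : r ∈ T.rotRing)
    {x d : ℂ} (h : T.Reaches x d) : T.Reaches (x + d * r) d := by
  -- Demanding both signs and all reachable edges at once makes `M` a group that is stable under
  -- multiplication by ρ.
  let M : AddSubgroup ℂ :=
    { carrier := {r | ∀ x d, T.Reaches x d → T.Reaches (x + d * r) d ∧ T.Reaches (x - d * r) d}
      zero_mem' := fun x d h => by simpa using h
      add_mem' := fun {a b} ha hb x d h => by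
        constructor
        · rw [mul_add, ← add_assoc]
          exact (hb _ _ (ha _ _ h).1).1
        · rw [mul_add, ← sub_sub]
          exact (hb _ _ (ha _ _ h).2).2
      neg_mem' := fun {a} ha x d h => by
        simpa [and_comm, ← sub_eq_add_neg] using ha x d h }
  have h1 : (1 : ℂ) ∈ M := fun x d h => by simpa using ⟨h.add hT, h.sub hT⟩
  have hback : ∀ x d, T.Reaches x (T.rot * d) → T.Reaches x d := fun x d h => by
    have := h.rotate_of_pow_eq_one hT (y := T.rot⁻¹) (by
      rw [inv_pow, (T.isPrimitiveRoot_rot hT).pow_eq_one, inv_one])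
    rwa [inv_mul_cancel_left₀ T.rot_ne_zero] at this
  -- Rotate the edge by θ, translate it by `r` times the rotated edge, and rotate it back.
  have h2 : ∀ r ∈ M, T.rot * r ∈ M := fun r hr x d h => by
    have := hr _ _ h.rotate
    rw [mul_comm T.rot d, mul_assoc, mul_comm d] at this
    exact ⟨hback _ _ (by simpa [mul_comm] using this.1),
      hback _ _ (by simpa [mul_comm] using this.2)⟩
  have h3 := adjoin_singleton_le_of_mul_mem h2 hr h1
  rw [mul_one] at h3
  exact (h3 x d h).1

theorem subset_pointsByDeformations (T : Trochoid) (p q : ℤ) (hp : T.m = p.natAbs)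
    (hq : T.n = q.natAbs) (h : T.m.Coprime T.n) : T.lattice ⊆ T.pointsByDeformations p q := by
  rintro z ⟨r, hr, rfl⟩
  have h0 : T.Reaches (T.w 0) (T.w 1 - T.w 0) :=
    ⟨0, T, Even.zero, .refl, rfl, rfl, rfl, rfl, rfl, by ring⟩
  obtain ⟨s, T', hs, hT, hm, -, hn, -, h1, -⟩ := h0.add_mul h hr
  have := T'.hm
  exact ⟨s, T', hm.trans hp, hn.trans hq, hs, hT, _,
    T'.uses_of_color p q _ _ (j := T'.m - 1) (by omega), by rw [T'.center_color_last, h1]⟩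

end Trochoid

theorem proposition6p5 (p q : ℤ) (hpq : IsCoprime p q) (hp : 2 ≤ |p|) (hq : 2 ≤ |q|)
    (T : Trochoid) (hm : T.m = p.natAbs) (hn : T.n = q.natAbs)
    (hside : ‖T.v 1 - T.v 0‖ = 1) :
    (T.coloring p q hm hn).pointsByMoves = T.pointsByDeformations p q ∧
    (T.coloring p q hm hn).pointsByMoves =
      {z : ℂ | ∃ a : ℕ → ℤ, z = T.vertex 0 0 +
        ∑ σ ∈ Finset.range (2 * T.alpha), (a σ : ℂ) * T.direction σ} := by
  have h : T.m.Coprime T.n := by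
    rw [hm, hn]
    exact Int.isCoprime_iff_gcd_eq_one.1 hpq
  have h1 : (T.coloring p q hm hn).pointsByMoves = T.lattice :=
    (T.pointsByMoves_subset p q hm hn h).antisymm (T.subset_pointsByMoves p q hm hn h)
  have h2 : T.pointsByDeformations p q = T.lattice :=
    (T.pointsByDeformations_subset p q h).antisymm (T.subset_pointsByDeformations p q hm hn h)
  rw [h1, h2]
  exact ⟨rfl, T.lattice_eq h (by rw [T.start_zero, T.start_one, hside])⟩
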